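/- **Conventions.** A local field $K$ is a nonarchimedean local field, with absolute Galois group $G_K$, inertia subgroup $I_K$ and residue field of size $q_K$. All homomorphisms from Galois groups to finite groups are continuous. Let $\Gamma$ be a finite group acting on a finite set $X$. A *counting function* $c$ for $\Gamma$ assigns to each homomorphism $\rho:G_K\to\Gamma$, $K$ any local field, an integer $c(\rho)\ge 0$, such that $c(\gamma\rho\gamma^{-1})=c(\rho)$ for $\gamma\in\Gamma$ and such that $c$ is compatible with isomorphisms of local fields. If the orbits of $\rho(G_K)$ on $X$ are $m_1,\dots,m_r$ and $m_i$ breaks up into $f_i$ orbits of size $e_i$ under $\rho(I_K)$, then $\rho$ has *type* $(f_1^{e_1}\cdots f_r^{e_r})$ (an unordered collection of symbols). Let $S$ be a class of local fields. $(\Gamma,c)$ has *mass formulas for $S$ by type* if for every type $\sigma$ there is $f_{(\Gamma,c,\sigma)}\in\mathbb Z[x]$ such that for all $K\in S$ the sum on the left converges and $$\sum_{\rho:G_K\to\Gamma\text{ of type }\sigma} q_K^{-c(\rho)}=f_{(\Gamma,c,\sigma)}(1/q_K).$$ **Theorem.** Let $A$ and $B$ be finite groups acting on finite sets $\mathcal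 A$ and $\mathcal B$, with counting functions $c_A$, $c_B$, and suppose that $(A,c_A)$ and $(B,c_B)$ have mass formulas for $S$ by type. (1) *Wreath products.* Fix a total order on $\mathcal B$, and let $A\wr B=A^{\mathcal B}\rtimes B$ act on $\mathcal B\times\mathcal A$, the disjoint union of copies of $\mathcal A$ indexed by $\mathcal B$. For $\rho:G_K\to A\wr B$ let $\bar\rho:G_K\to B$ be the quotient; for $j\in\mathcal B$ let $L_j$ be the fixed field of the stabilizer of $j$ in $G_K$, and $\rho_j:G_{L_j}\to A$ the action on the $j$-th copy of $\mathcal A$. Let $i$ run through the least elements of the orbits of $\bar\rho(G_K)$ on $\mathcal B$, and let $f_i^{e_i}$ be the symbol of the orbit of $i$. Then $$c(\rho)=c_B(\bar\rho)+\sum_i f_i\,c_A(\rho_i)$$ is a counting function for $A\wr B$. Suppose moreover that for all $K\in S$, all $\phi:G_K\to B$ and all $j\in\mathcal B$ the fixed field of the stabilizer of $j$ is in $S$ (for example, that $S$ is closed under finite separable extensions). Then $(A\wr B,c)$ has mass formulas for $S$ by type. More precisely, say that $\rho$ has *wreath type* $\Sigma=(f_1^{e_1}(\sigma_1)\cdots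 f_r^{e_r}(\sigma_r))$ if $\bar\rho$ has type $\sigma=(f_1^{e_1}\cdots f_r^{e_r})$ and, for every symbol $f^e$, the types of the $\rho_i$ with $f_i^{e_i}=f^e$, in increasing order of $i$, are the $\sigma_k$ with $f_k^{e_k}=f^e$, in increasing order of $k$. Then for every $\Sigma$, every $K\in S$ and every choice of the polynomials $f_{(A,c_A,\cdot)}$ and $f_{(B,c_B,\cdot)}$, the following sum converges and $$\sum_{\rho:G_K\to A\wr B\text{ of wreath type }\Sigma} q_K^{-c(\rho)}=|A|^{|\mathcal B|-r}\,f_{(B,c_B,\sigma)}(1/q_K)\prod_{k=1}^r f_{(A,c_A,\sigma_k)}\big(1/q_K^{f_k}\big).$$ (If $r>|\mathcal B|$, no $\rho$ has wreath type $\Sigma$ and both sides are $0$.) (2) *Direct products.* Let $A\times B$ act on the disjoint union $\mathcal A\sqcup\mathcal B$. Then $c''(\rho\times\rho')=c_A(\rho)+c_B(\rho')$ is a counting function for $A\times B$, and $(A\times B,c'')$ has mass formulas for $S$ by type. More precisely, for all types $\sigma,\sigma'$ and all $K\in S$, the following sum converges and $$\sum_{\rho\times\rho'\,:\ \rho\text{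 of type }\sigma,\ \rho'\text{ of type }\sigma'} q_K^{-c''(\rho\times\rho')}=f_{(A,c_A,\sigma)}(1/q_K)\,f_{(B,c_B,\sigma')}(1/q_K).$$ -/

import Mathlib

universe u

noncomputable section

namespace MassFormula

open scoped ValuativeRel

/-! ### Local fields, residue cardinality, inertia -/

/-- `K` is a (nonarchimedean) local field and `O` is its ring of integers.  A local field is recorded
as the pair `(K, O)`: the valuation (up to equivalence) and the topology are determined by `O`. -/
def IsLocalField (K : Type u) [Field K] (O : Subring K) : Prop :=
  ∃ (_ : ValuativeRel K) (_ : TopologicalSpace K),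
    IsNonarchimedeanLocalField K ∧ O = 𝒪[K]

/-- The cardinality `q_K` of the residue field of the local ring `O`
(whose Jacobson radical is its maximal ideal). -/
def residueCard {K : Type u} [Field K] (O : Subring K) : ℕ :=
  Nat.card (O ⧸ Ideal.jacobson (⊥ : Ideal O))

/-- The ring of integers of an extension `L` of `K`: the elements that are integral over `O`. -/
def integersIn {K : Type u} [Field K] (O : Subring K) (L : Type u) [Field L] [Algebra K L] :
    Subring L :=
  (integralClosure O L).toSubring

theorem map_mem_integersIn {K Ω : Type u} [Field K] [Field Ω] [Algebra K Ω] (O : Subring K)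
    (g : Gal(Ω/K)) {x : Ω} (hx : x ∈ integersIn O Ω) : g x ∈ integersIn O Ω :=
  IsIntegral.map (g.toAlgHom.restrictScalars O) hx

/-- The inertia group of `Gal(Ω/K)`: the automorphisms that act trivially on the residue field of
the ring of integers of `Ω` (a local ring when `Ω` is a separable closure of the local field
`K`, so that its Jacobson radical is its maximal ideal). -/
def inertia {K : Type u} [Field K] (O : Subring K) (Ω : Type u) [Field Ω] [Algebra K Ω] :
    Subgroup Gal(Ω/K) where
  carrier := {g | ∀ x ∈ integersIn O Ω,
    ∃ m ∈ Ideal.jacobson (⊥ : Ideal (integersIn O Ω)), (m : Ω) = g x - x}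
  one_mem' := fun x _ => ⟨0, Ideal.zero_mem _, by simp⟩
  mul_mem' := by
    intro g h hg hh x hx
    obtain ⟨m₁, hm₁, h₁⟩ := hg (h x) (map_mem_integersIn O h hx)
    obtain ⟨m₂, hm₂, h₂⟩ := hh x hx
    exact ⟨m₁ + m₂, Ideal.add_mem _ hm₁ hm₂, by simp [h₁, h₂]⟩
  inv_mem' := by
    intro g hg x hx
    obtain ⟨m, hm, h⟩ := hg (g⁻¹ x) (map_mem_integersIn O g⁻¹ hx)
    refine ⟨-m, (Ideal.neg_mem_iff _).2 hm, ?_⟩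
    have h' : g (g⁻¹ x) = x := g.apply_symm_apply x
    rw [h'] at h
    simp [h]

/-! ### Galois representations -/

/-- The set `S_{K,Γ}` of homomorphisms `Gal(Ω/K) → Γ` that are continuous for the Krull topology
and the discrete topology on `Γ`. -/
def Rep (K Ω Γ : Type*) [Field K] [Field Ω] [Algebra K Ω] [Group Γ] :=
  {ρ : Gal(Ω/K) →* Γ // @Continuous Gal(Ω/K) Γ (krullTopology K Ω) ⊥ ρ}

section Rep

variable {K Ω Γ Δ : Type*} [Field K] [Field Ω] [Algebra K Ω] [Group Γ] [Group Δ]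

theorem continuous_comp_discrete {G Γ Δ : Type*} [TopologicalSpace G] {ρ : G → Γ}
    (h : @Continuous G Γ _ ⊥ ρ) (φ : Γ → Δ) : @Continuous G Δ _ ⊥ fun g => φ (ρ g) := by
  let _ : TopologicalSpace Γ := ⊥
  let _ : TopologicalSpace Δ := ⊥
  have : DiscreteTopology Γ := ⟨rfl⟩
  exact (continuous_of_discreteTopology (f := φ)).comp h

/-- The composite of a representation with a homomorphism `Γ → Δ`. -/
def Rep.map (φ : Γ →* Δ) (ρ : Rep K Ω Γ) : Rep K Ω Δ :=
  ⟨φ.comp ρ.1, continuous_comp_discrete ρ.2 φ⟩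

/-- The representation `γ ρ γ⁻¹`. -/
def Rep.conj (γ : Γ) (ρ : Rep K Ω Γ) : Rep K Ω Γ :=
  ρ.map (MulAut.conj γ).toMonoidHom

/-- The stabilizer of the point `x` in the Galois group acting through `ρ`. -/
def Rep.stab {X : Type*} [MulAction Γ X] (ρ : Rep K Ω Γ) (x : X) : Subgroup Gal(Ω/K) :=
  (MulAction.stabilizer Γ x).comap ρ.1

/-- The fixed field of the stabilizer of the point `x`. -/
def Rep.pointField {X : Type*} [MulAction Γ X] (ρ : Rep K Ω Γ) (x : X) : IntermediateField K Ω :=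
  IntermediateField.fixedField (ρ.stab x)

end Rep

/-! ### Types -/

section Types

variable {K Ω : Type u} [Field K] [Field Ω] [Algebra K Ω] {Γ X : Type*} [Group Γ] [MulAction Γ X]

/-- The symbol `f^e`, recorded as the pair `(f, e)`, of the orbit of `x` under the Galois group:
this orbit breaks up into `f` orbits of size `e` under the inertia group. -/
def symbolAt (O : Subring K) (ρ : Rep K Ω Γ) (x : X) : ℕ × ℕ :=
  (((fun y : X => MulAction.orbit ((inertia O Ω).map ρ.1) y) ''
      (MulAction.orbit ρ.1.range x)).ncard,
    (MulAction.orbit ((inertia O Ω).map ρ.1) x).ncard)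

variable (X) in
open Classical in
/-- The type `(f₁^{e₁} ⋯ f_r^{e_r})` of a representation: the multiset of the symbols of its orbits
on `X`. -/
def repType [Fintype X] (O : Subring K) (ρ : Rep K Ω Γ) : Multiset (ℕ × ℕ) :=
  (Finset.univ : Finset (MulAction.orbitRel.Quotient ρ.1.range X)).val.map
    (fun o => symbolAt O ρ o.out)

end Types

/-! ### Counting functions and mass formulas by type -/

/-- Functions that assign a natural number to each representation into `Γ` of the
absolute Galois group (formed with an arbitrary separable closure) of each local field. -/
abbrev RepFunction (Γ : Type*) [Group Γ] :=
  ∀ (K Ω : Type u) [Field K] [Field Ω] [Algebra K Ω] [IsSepClosure K Ω] (_ : Subring K),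
    Rep K Ω Γ → ℕ

/-- `c` is a counting function for `Γ`: it is invariant under conjugation by `Γ`, and it only depends
on the isomorphism class of the local field (an isomorphism `e` of local fields together with
an extension `E` of it to the separable closures identifies the absolute Galois groups). -/
structure IsCountingFunction {Γ : Type*} [Group Γ] (c : RepFunction.{u} Γ) : Prop where
  conj_eq : ∀ (K Ω : Type u) [Field K] [Field Ω] [Algebra K Ω] [IsSepClosure K Ω] (O : Subring K),
    IsLocalField K O → ∀ (ρ : Rep K Ω Γ) (γ : Γ), c K Ω O (ρ.conj γ) = c K Ω O ρ
  iso_eq : ∀ (K Ω : Type u) [Field K] [Field Ω] [Algebra K Ω] [IsSepClosure K Ω] (O : Subring K)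
    (K' Ω' : Type u) [Field K'] [Field Ω'] [Algebra K' Ω'] [IsSepClosure K' Ω'] (O' : Subring K'),
    IsLocalField K O → IsLocalField K' O' →
    ∀ (e : K ≃+* K') (E : Ω ≃+* Ω'), O.map (e : K →+* K') = O' →
      (∀ x : K, E (algebraMap K Ω x) = algebraMap K' Ω' (e x)) →
      ∀ (ρ : Rep K Ω Γ) (ρ' : Rep K' Ω' Γ),
        (∀ (g : Gal(Ω/K)) (g' : Gal(Ω'/K')), (∀ x : Ω, E (g x) = g' (E x)) → ρ.1 g = ρ'.1 g') →
        c K Ω O ρ = c K' Ω' O' ρ'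

/-- A class of local fields; only its members `(K, O)` with `IsLocalField K O` are used. -/
abbrev FieldClass := ∀ (K : Type u) [Field K], Subring K → Prop

section Mass

variable {Γ : Type*} [Group Γ] (X : Type*) [Fintype X] [MulAction Γ X]

/-- For every local field `K` in `S`, the total mass of `(K, Γ, c, σ)` converges and
is equal to `f(1/q_K)`. -/
def IsMassFormula (S : FieldClass.{u}) (c : RepFunction.{u} Γ) (σ : Multiset (ℕ × ℕ))
    (f : Polynomial ℤ) : Prop :=
  ∀ (K Ω : Type u) [Field K] [Field Ω] [Algebra K Ω] [IsSepClosure K Ω] (O : Subring K),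
    IsLocalField K O → S K O →
    HasSum (fun ρ : {ρ : Rep K Ω Γ // repType X O ρ = σ} =>
        ((residueCard O : ℝ) ^ c K Ω O ρ.1)⁻¹)
      (Polynomial.aeval ((residueCard O : ℝ)⁻¹) f)

/-- `(Γ, c)` has mass formulas for `S` by type. -/
def HasMassFormulasByType (S : FieldClass.{u}) (c : RepFunction.{u} Γ) : Prop :=
  ∀ σ : Multiset (ℕ × ℕ), ∃ f : Polynomial ℤ, IsMassFormula X S c σ f

end Mass

/-! ### Wreath products -/

/-- The wreath product `A ≀ B`, for `B` acting on `Y`: the semidirect product of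
`A^Y` with `B`, where `(b • F) j = F (b⁻¹ • j)`. -/
abbrev Wreath (A B Y : Type*) [Group A] [Group B] [MulAction B Y] :=
  SemidirectProduct (Y → A) B (mulAutArrow (G := B) (A := Y) (M := A))

/-- The natural action of `A ≀ B` on the disjoint union `Y × X` of copies of `X` indexed by `Y`. -/
instance wreathAction (A B Y X : Type*) [Group A] [Group B] [MulAction B Y] [MulAction A X] :
    MulAction (Wreath A B Y) (Y × X) where
  smul w p := (w.right • p.1, w.left (w.right • p.1) • p.2)
  one_smul p := by
    change ((1 : B) • p.1, (1 : A) • p.2) = p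
    simp
  mul_smul v w p := by
    change ((v.right * w.right) • p.1,
        (v.left ((v.right * w.right) • p.1) *
          w.left (v.right⁻¹ • (v.right * w.right) • p.1)) • p.2) =
      (v.right • w.right • p.1,
        v.left (v.right • w.right • p.1) • w.left (w.right • p.1) • p.2)
    simp [mul_smul]

/-- A separable closure of `K` is a separable closure of each of its subfields over `K`. -/
instance isSepClosure_intermediate {K Ω : Type*} [Field K] [Field Ω] [Algebra K Ω]
    [IsSepClosure K Ω] (L : IntermediateField K Ω) : IsSepClosure L Ω :=
  ⟨IsSepClosure.sep_closed K, Algebra.isSeparable_tower_top_of_isSeparable K L Ω⟩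

/-- The inclusion `Gal(Ω/L) → Gal(Ω/K)`. -/
def galRes {K Ω : Type*} [Field K] [Field Ω] [Algebra K Ω] (L : IntermediateField K Ω) :
    Gal(Ω/L) →* Gal(Ω/K) :=
  AlgEquiv.restrictScalarsHom K

theorem galRes_continuous {K Ω : Type*} [Field K] [Field Ω] [Algebra K Ω]
    [Algebra.IsAlgebraic K Ω] (L : IntermediateField K Ω) : Continuous (galRes L) := by
  refine continuous_of_continuousAt_one _ ?_
  intro s hs
  rw [map_one, krullTopology_mem_nhds_one_iff] at hs
  obtain ⟨E, hE, hs⟩ := hs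
  let b := Module.finBasis K E
  have halg : Algebra.IsIntegral L Ω := ⟨fun x => (Algebra.IsIntegral.isIntegral (R := K) x).tower_top⟩
  have hopen : IsOpen (⋂ i, (MulAction.stabilizer Gal(Ω/L) ((b i : E) : Ω) : Set Gal(Ω/L))) :=
    isOpen_iInter_of_finite fun i => stabilizer_isOpen_of_isIntegral (K := L) _
  refine Filter.mem_map.2 (Filter.mem_of_superset (hopen.mem_nhds (Set.mem_iInter.2 fun i => one_mem _)) ?_)
  intro g hg
  apply hs
  rw [SetLike.mem_coe, IntermediateField.mem_fixingSubgroup_iff]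
  intro x hx
  have key : (galRes L g).toAlgHom.toLinearMap ∘ₗ E.val.toLinearMap = E.val.toLinearMap := by
    refine b.ext fun i => ?_
    have := Set.mem_iInter.1 hg i
    exact this
  exact LinearMap.congr_fun key ⟨x, hx⟩

theorem Rep.stab_isClosed {K Ω Γ X : Type*} [Field K] [Field Ω] [Algebra K Ω] [Group Γ]
    [MulAction Γ X] (ρ : Rep K Ω Γ) (x : X) : IsClosed (ρ.stab x : Set Gal(Ω/K)) := by
  let _ : TopologicalSpace Γ := ⊥
  have : DiscreteTopology Γ := ⟨rfl⟩
  exact (isClosed_discrete (MulAction.stabilizer Γ x : Set Γ)).preimage ρ.2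

theorem galRes_mem_stab {K Ω Γ X : Type*} [Field K] [Field Ω] [Algebra K Ω] [IsSepClosure K Ω]
    [Group Γ] [MulAction Γ X] (ρ : Rep K Ω Γ) (x : X) (g : Gal(Ω/ρ.pointField x)) :
    galRes (ρ.pointField x) g ∈ ρ.stab x := by
  have h := InfiniteGalois.fixingSubgroup_fixedField (k := K) (K := Ω)
    ⟨ρ.stab x, ρ.stab_isClosed x⟩
  change (ρ.pointField x).fixingSubgroup = ρ.stab x at h
  rw [← h, IntermediateField.mem_fixingSubgroup_iff]
  intro y hy
  exact g.commutes ⟨y, hy⟩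

section WreathRep

variable {K Ω : Type u} [Field K] [Field Ω] [Algebra K Ω]
variable {A B Y : Type*} [Group A] [Group B] [MulAction B Y]

/-- The quotient `ρ̄ : Gal(Ω/K) → B` of `ρ : Gal(Ω/K) → A ≀ B`. -/
def barRep (ρ : Rep K Ω (Wreath A B Y)) : Rep K Ω B :=
  ρ.map SemidirectProduct.rightHom

/-- The representation `ρ_j : Gal(Ω/L_j) → A`, where `L_j` is the fixed field of the stabilizer of
`j`, given by the action on the `j`-th copy of the set on which `A` acts. -/
def pointRep [IsSepClosure K Ω] (ρ : Rep K Ω (Wreath A B Y)) (j : Y) :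
    Rep ((barRep ρ).pointField j) Ω A :=
  ⟨{ toFun := fun g => (ρ.1 (galRes _ g)).left j
     map_one' := by simp
     map_mul' := by
      intro g h
      have hg : (ρ.1 (galRes _ g)).right • j = j := galRes_mem_stab (barRep ρ) j g
      have hg' : (ρ.1 (galRes _ g)).right⁻¹ • j = j := by rw [inv_smul_eq_iff, hg]
      rw [map_mul, map_mul, SemidirectProduct.mul_left]
      change _ * (ρ.1 (galRes _ h)).left ((ρ.1 (galRes _ g)).right⁻¹ • j) = _
      rw [hg'] },
    by
      let _ : TopologicalSpace (Wreath A B Y) := ⊥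
      exact continuous_comp_discrete (Continuous.comp ρ.2 (galRes_continuous _))
        fun w : Wreath A B Y => w.left j⟩

variable [Fintype Y] [LinearOrder Y]

open Classical in
/-- The canonical representatives of the orbits of `ρ̄` on `Y` (the least element of each
orbit), in increasing order. -/
def orbitReps (φ : Rep K Ω B) : List Y :=
  (Finset.univ.filter fun j : Y => ∀ k ∈ MulAction.orbit φ.1.range j, j ≤ k).sort (· ≤ ·)

/-- The list of the terms `f_i^{e_i}(σ_i)`, where `i` runs through the canonical orbit representatives
of `ρ̄` in increasing order, `f_i^{e_i}` is the symbol of the orbit of `i` and `σ_i` is the type of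
`ρ_i`. -/
def wreathTerms (X : Type*) [Fintype X] [MulAction A X] [IsSepClosure K Ω] (O : Subring K)
    (ρ : Rep K Ω (Wreath A B Y)) : List ((ℕ × ℕ) × Multiset (ℕ × ℕ)) :=
  (orbitReps (barRep ρ)).map fun i =>
    (symbolAt O (barRep ρ) i, repType X (integersIn O ((barRep ρ).pointField i)) (pointRep ρ i))

/-- `ρ` has wreath type `T = (f₁^{e₁}(σ₁) ⋯ f_r^{e_r}(σ_r))`.  The type `(f₁^{e₁} ⋯ f_r^{e_r})` of
`ρ̄` is unordered, and terms of `T` whose symbols `f^e` are equal correspond in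
order to the canonical orbit representatives with that symbol. -/
def HasWreathType (X : Type*) [Fintype X] [MulAction A X] [IsSepClosure K Ω] (O : Subring K)
    (ρ : Rep K Ω (Wreath A B Y)) (T : List ((ℕ × ℕ) × Multiset (ℕ × ℕ))) : Prop :=
  ∀ s : ℕ × ℕ, (wreathTerms X O ρ).filter (fun t => t.1 = s) = T.filter (fun t => t.1 = s)

end WreathRep

/-- The function `c(ρ) = c_B(ρ̄) + ∑ᵢ fᵢ c_A(ρᵢ)`, where `i` runs through the canonical orbit
representatives of `ρ̄`. -/
def wreathCount {A B : Type*} (Y : Type*) [Group A] [Group B] [MulAction B Y] [Fintype Y]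
    [LinearOrder Y] (cA : RepFunction.{u} A) (cB : RepFunction.{u} B) :
    RepFunction.{u} (Wreath A B Y) :=
  fun K Ω _ _ _ _ O ρ =>
    cB K Ω O (barRep ρ) +
      ((orbitReps (barRep ρ)).map fun i : Y =>
        (symbolAt O (barRep ρ) i).1 *
          cA ((barRep ρ).pointField i) Ω (integersIn O ((barRep ρ).pointField i))
            (pointRep ρ i)).sum

/-- The class `S` contains, for every `K` in `S` and every representation `φ : Gal(Ω/K) → B`, the
fixed fields of the stabilizers of the points of `Y`.  This holds in particular when `S` is
closed under finite separable extensions. -/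
def ContainsPointFields (S : FieldClass.{u}) (B Y : Type*) [Group B] [MulAction B Y] : Prop :=
  ∀ (K Ω : Type u) [Field K] [Field Ω] [Algebra K Ω] [IsSepClosure K Ω] (O : Subring K),
    IsLocalField K O → S K O →
    ∀ (φ : Rep K Ω B) (j : Y), S (φ.pointField j) (integersIn O (φ.pointField j))

/-! ### Direct products -/

/-- The natural action of `A × B` on the disjoint union `X ⊕ Y`. -/
instance prodAction (A B X Y : Type*) [Group A] [Group B] [MulAction A X] [MulAction B Y] :
    MulAction (A × B) (X ⊕ Y) where
  smul g := Sum.map (g.1 • ·) (g.2 • ·)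
  one_smul p := by
    change Sum.map ((1 : A) • ·) ((1 : B) • ·) p = p
    cases p <;> simp
  mul_smul g h p := by
    change Sum.map ((g.1 * h.1) • ·) ((g.2 * h.2) • ·) p =
      Sum.map (g.1 • ·) (g.2 • ·) (Sum.map (h.1 • ·) (h.2 • ·) p)
    cases p <;> simp [mul_smul]

/-- The function `c(ρ × ρ') = c_A(ρ) + c_B(ρ')`. -/
def prodCount {A B : Type*} [Group A] [Group B] (cA : RepFunction.{u} A) (cB : RepFunction.{u} B) :
    RepFunction.{u} (A × B) :=
  fun K Ω _ _ _ _ O ρ =>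
    cA K Ω O (ρ.map (MonoidHom.fst A B)) + cB K Ω O (ρ.map (MonoidHom.snd A B))

/-- `ρ × ρ'` has product type `(σ, σ')`: `ρ` has type `σ` and `ρ'` has type `σ'`. -/
def HasProductType {K Ω : Type u} [Field K] [Field Ω] [Algebra K Ω] {A B : Type*} (X Y : Type*)
    [Group A] [Group B] [Fintype X] [MulAction A X] [Fintype Y] [MulAction B Y] (O : Subring K)
    (ρ : Rep K Ω (A × B)) (σ τ : Multiset (ℕ × ℕ)) : Prop :=
  repType X O (ρ.map (MonoidHom.fst A B)) = σ ∧ repType Y O (ρ.map (MonoidHom.snd A B)) = τ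

end MassFormula

end

noncomputable section

namespace MassFormula

open scoped ValuativeRel

/-! Fix `φ : G_K → B` and count the `ρ : G_K → A ≀ B` above it. For each orbit of `φ` on `Y` take
its least element `i`, and for each `j` in the orbit a Galois element `t_j` carrying `i` to `j`,
with `t_i = 1`. For `g` in `G_K` the loop `t_j⁻¹ g t_{g⁻¹j}` fixes `i`, so it lies in the Galois
group of `L_i`, and the `j`-th component of `ρ(g)` must be `a_j · ρ_i(loop) · a_{g⁻¹j}⁻¹`, where
`a_j` is the `j`-th component of `ρ(t_j)` and `a_i = 1`. Conversely, any representations `ρ_i` of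
the groups `G_{L_i}` and any elements `a_j`, for `j` not least in its orbit, define a continuous
lift. This bijection (`liftsEquiv`) produces the factor `|A|^{|Y|-r}`.

The weights factor because `q_{L_i} = q_K^{f_i}` (`residueCard_pointField`): the term `f_i c_A(ρ_i)`
in the exponent of `q_K` is the exponent `c_A(ρ_i)` of `q_{L_i}`. So the sum over lifts of `φ` of a
given wreath type is `q_K^{-c_B(φ)}` times a product of masses for `A` over the fields `L_i`, and
its remaining factor is the same for all `φ` of the given type. Summing over `φ` gives the
polynomial of `B`. All terms are nonnegative, so expanding products and reordering need no further
convergence argument.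

The residue degree is computed in the Galois group: `G_K` surjects onto the automorphisms of the
residue extension with kernel the inertia group `I`, so the residue degree of `L` is the index of `I
· G_L` (`residueCard_extension`). For the stabilizer of a point this index is also the number of
inertia orbits in its Galois orbit (`symbolAt_fst`).

For types instead of wreath types, symbols multiply in the tower `K ⊆ L_i ⊆ L_{(i,x)}`
(`symbolAt_wreath`), so the wreath type determines the type. Finitely many wreath types occur, with
a bound independent of `K`, and the polynomials add up. The function `c` is a counting function
because conjugation, isomorphism of fields and change of orbit representative are instances of one
transport statement (`count_pointRep_transport`). Direct products are the same argument for
independent pairs. -/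

/-! ### Local fields as ultrametric normed fields -/

theorem IsLocalField.exists_norm {K : Type u} [inst : Field K] {O : Subring K}
    (h : IsLocalField K O) :
    ∃ n : NontriviallyNormedField K, n.toNormedField.toField = inst ∧ IsUltrametricDist K ∧
      ProperSpace K ∧ ∀ x : K, x ∈ O ↔ ‖x‖ ≤ 1 := by
  obtain ⟨vr, top, h, rfl⟩ := h
  let := IsTopologicalAddGroup.rightUniformSpace K
  have := isUniformAddGroup_of_addCommGroup (G := K)
  let rk : (Valued.v (R := K) (Γ₀ := ValuativeRel.ValueGroupWithZero K)).RankOne :=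
  { hom' := ValuativeRel.IsRankLeOne.nonempty.some.emb (R := K).comp
      MonoidWithZeroHom.ValueGroup₀.embedding
    strictMono' := ValuativeRel.IsRankLeOne.nonempty.some.strictMono.comp
        MonoidWithZeroHom.ValueGroup₀.embedding_strictMono }
  let := Valued.toNontriviallyNormedField (L := K) (Γ₀ := ValuativeRel.ValueGroupWithZero K)
  refine ⟨this, rfl, inferInstance, .of_nontriviallyNormedField_of_weaklyLocallyCompactSpace K, ?_⟩
  intro x
  exact (Valued.toNormedField.norm_le_one_iff (hv := rk)).symm

/-- Together with `IsLocalField.exists_norm` this gives a criterion stable under finite extensions: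
properness and the ultrametric inequality pass to the spectral norm. -/
theorem isLocalField_of_norm {K : Type u} [NontriviallyNormedField K] [IsUltrametricDist K]
    [ProperSpace K] {O : Subring K} (hO : ∀ x : K, x ∈ O ↔ ‖x‖ ≤ 1) : IsLocalField K O := by
  let v : Valuation K NNReal := NormedField.valuation
  let _ := ValuativeRel.ofValuation v
  have : v.Compatible := .ofValuation v
  let _ : Valued K NNReal := NormedField.toValued
  have : IsValuativeTopology K :=
    .of_mem_nhds_zero_iff_vle v fun {s} => Valued.mem_nhds_zero
  refine ⟨inferInstance, inferInstance, { condition := ?_}, ?_⟩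
  · obtain ⟨x, hx⟩ := NormedField.exists_one_lt_norm K
    refine ⟨ValuativeRel.valuation K x, ?_, ?_⟩
    · simp only [ne_eq, map_eq_zero]
      rintro rfl
      simp at hx
      linarith
    · refine ne_of_gt (((ValuativeRel.valuation K).vlt_iff_lt (x := 1) (y := x)).1 ?_ |>.trans_eq' (by simp))
      rw [v.vlt_iff_lt]
      rw [map_one]
      exact NNReal.coe_lt_coe.1 (by simpa [v] using hx)
  · ext x
    rw [hO, Valuation.mem_integer_iff, ← (ValuativeRel.valuation K).vle_one_iff, v.vle_one_iff]
    rfl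

section Normed

variable {K : Type u} [NontriviallyNormedField K] [IsUltrametricDist K]
  {O : Subring K} (hO : ∀ x : K, x ∈ O ↔ ‖x‖ ≤ 1)
  {L : Type u} [Field L] [Algebra K L] [Algebra.IsAlgebraic K L]

-- The unit ball of the spectral norm is a valuation ring containing `O`, hence integrally closed.
-- Conversely, spectral norm at most 1 means that all coefficients of the minimal polynomial have
-- norm at most 1, so this polynomial is already an integral equation over `O`.
include hO in
theorem mem_integersIn_iff [CompleteSpace K] (x : L) : x ∈ integersIn O L ↔ spectralNorm K L x ≤ 1 := by
  constructor
  · intro h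
    have h : IsIntegral O x := h
    let _ := spectralNorm.normedField K L
    have : IsUltrametricDist L := ⟨by
      intro a b c
      have := isNonarchimedean_spectralNorm (K := K) (L := L) (a - b) (b - c)
      rwa [sub_add_sub_cancel] at this⟩
    have hv : (NormedField.valuation (K := L)).Integers (NormedField.valuation (K := L)).integer :=
      Valuation.integer.integers _
    let f : O →+* (NormedField.valuation (K := L)).integer :=
      ((algebraMap K L).comp O.subtype).codRestrict _ (by
        intro y
        change spectralNorm K L (algebraMap K L y) ≤ 1
        rw [spectralNorm_extends]
        exact (hO y).1 y.2)
    obtain ⟨p, hp, hpx⟩ := h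
    have := hv.mem_of_integral (x := x) ⟨p.map f, hp.map f, by
      rw [Polynomial.eval₂_map]; exact hpx⟩
    exact this
  · intro h
    have hm := minpoly.monic (Algebra.IsIntegral.isIntegral (R := K) x)
    rw [spectralNorm, spectralValue_le_one_iff hm] at h
    have hl : (minpoly K x) ∈ Polynomial.lifts O.subtype := by
      rw [Polynomial.lifts_iff_coeff_lifts]
      intro n
      simpa using (hO _).2 (h n)
    obtain ⟨q, hq, -, hqm⟩ := Polynomial.lifts_and_natDegree_eq_and_monic hl hm
    refine ⟨q, hqm, ?_⟩
    have := minpoly.aeval K x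
    rw [← hq, Polynomial.aeval_def, Polynomial.eval₂_map] at this
    exact this

end Normed

/-- A finite extension of a local field is a local field. -/
theorem IsLocalField.extension {K : Type u} [Field K] {O : Subring K} (h : IsLocalField K O)
    (L : Type u) [Field L] [Algebra K L] [FiniteDimensional K L] :
    IsLocalField L (integersIn O L) := by
  obtain ⟨n, rfl, h₁, h₂, hO⟩ := h.exists_norm
  have key := mem_integersIn_iff hO (L := L)
  let _ := spectralNorm.nontriviallyNormedField K L
  let _ := spectralNorm.normedAlgebra K L
  have : IsUltrametricDist L := ⟨by
      intro a b c
      have := isNonarchimedean_spectralNorm (K := K) (L := L) (a - b) (b - c)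
      rwa [sub_add_sub_cancel] at this⟩
  have : ProperSpace L := FiniteDimensional.proper K L
  exact isLocalField_of_norm key

/-- The spectral norm is multiplicative. This makes the integers a valuation ring, hence local, in
every algebraic extension, including the infinite extension `Ω`; the Jacobson radical in `inertia`
is then the maximal ideal. -/
theorem IsLocalField.mem_or_inv_mem {K : Type u} [Field K] {O : Subring K} (h : IsLocalField K O)
    (L : Type u) [Field L] [Algebra K L] [Algebra.IsAlgebraic K L] (x : L) :
    x ∈ integersIn O L ∨ x⁻¹ ∈ integersIn O L := by
  obtain ⟨n, rfl, h₁, h₂, hO⟩ := h.exists_norm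
  rw [mem_integersIn_iff hO, mem_integersIn_iff hO]
  let _ := spectralNorm.normedField K L
  change ‖x‖ ≤ 1 ∨ ‖x⁻¹‖ ≤ 1
  rw [norm_inv]
  rcases le_total ‖x‖ 1 with h | h
  · exact .inl h
  · exact .inr (inv_le_one_of_one_le₀ h)

theorem isLocalRing_of_mem_or_inv_mem {L : Type*} [Field L] (R : Subring L)
    (h : ∀ x : L, x ∈ R ∨ x⁻¹ ∈ R) : IsLocalRing R :=
  inferInstanceAs (IsLocalRing (ValuationSubring.ofSubring R h))

theorem IsLocalField.isLocalRing {K : Type u} [Field K] {O : Subring K} (h : IsLocalField K O)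
    (L : Type u) [Field L] [Algebra K L] [Algebra.IsAlgebraic K L] :
    IsLocalRing (integersIn O L) :=
  isLocalRing_of_mem_or_inv_mem _ (h.mem_or_inv_mem L)

theorem IsLocalField.isLocalRing_self {K : Type u} [Field K] {O : Subring K}
    (h : IsLocalField K O) : IsLocalRing O := by
  obtain ⟨vr, top, h, rfl⟩ := h
  exact inferInstanceAs (IsLocalRing 𝒪[K])

theorem IsLocalField.integersIn_self {K : Type u} [Field K] {O : Subring K}
    (h : IsLocalField K O) : integersIn O K = O := by
  obtain ⟨n, rfl, h₁, h₂, hO⟩ := h.exists_norm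
  ext x
  rw [mem_integersIn_iff hO, hO]
  have := spectralNorm_extends (K := K) (L := K) x
  rw [← this]; rfl

theorem IsLocalField.finite_residue {K : Type u} [Field K] {O : Subring K}
    (h : IsLocalField K O) : Finite (O ⧸ Ideal.jacobson (⊥ : Ideal O)) := by
  have := h.isLocalRing_self
  obtain ⟨vr, top, h, rfl⟩ := h
  have h : Finite 𝓀[K] := inferInstance
  rw [IsLocalRing.jacobson_eq_maximalIdeal _ bot_ne_top]
  exact h

theorem residueCard_pos {K : Type u} [Field K] {O : Subring K}
    (h : IsLocalField K O) : 0 < residueCard O := by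
  have := h.finite_residue
  exact Nat.card_pos

/-- Integral closures are transitive. -/
theorem integersIn_integersIn {K Ω : Type u} [Field K] [Field Ω] [Algebra K Ω] (O : Subring K)
    (L : IntermediateField K Ω) :
    integersIn (integersIn O L) Ω = integersIn O Ω := by
  ext x
  have : IsScalarTower O (integralClosure O L) Ω := by
    exact IsScalarTower.of_algebraMap_eq fun _ => rfl
  constructor
  · intro h
    have h : IsIntegral (integralClosure O L) x := h
    exact isIntegral_trans (R := O) (A := integralClosure O L) x h
  · intro h
    have h : IsIntegral O x := h
    exact h.tower_top (A := integralClosure O L)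

/-! ### Residue fields and the Galois group -/

section Profinite

variable {K Ω : Type u} [Field K] [Field Ω] [Algebra K Ω]

/-- An automorphism of the residue field that fixes the image of the ring of integers of `K` is
induced by an element of the Galois group. -/
theorem exists_galois_lift [IsSepClosure K Ω] {O : Subring K} (hO : IsLocalField K O)
    (R : Subring Ω) [IsLocalRing R] (hR : R = integersIn O Ω)
    (τ : IsLocalRing.ResidueField R ≃+* IsLocalRing.ResidueField R)
    (hτ : ∀ (a : O) (r : R), (r : Ω) = algebraMap K Ω a →
      τ (IsLocalRing.residue R r) = IsLocalRing.residue R r) :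
    ∃ g : Gal(Ω/K), ∀ r s : R, (s : Ω) = g r → IsLocalRing.residue R s = τ (IsLocalRing.residue R r) := by
  let f : O →+* R := ((algebraMap K Ω).comp O.subtype).codRestrict R (fun y => by
    rw [hR]; exact isIntegral_algebraMap (A := Ω) (x := y))
  let _ : Algebra O R := f.toAlgebra
  let act : MulSemiringAction Gal(Ω/K) R :=
    { smul := fun g r => ⟨g r, hR.symm.le (map_mem_integersIn O g (hR.le r.2))⟩
      one_smul := fun r => rfl
      mul_smul := fun g h r => rfl
      smul_zero := fun g => Subtype.ext (map_zero g)
      smul_add := fun g r s => Subtype.ext (map_add g _ _)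
      smul_one := fun g => Subtype.ext (map_one g)
      smul_mul := fun g r s => Subtype.ext (map_mul g _ _) }
  have hact (g : Gal(Ω/K)) (r : R) : ((g • r : R) : Ω) = g r := rfl
  have : SMulCommClass Gal(Ω/K) O R := ⟨fun g a r => Subtype.ext (by
    rw [hact, Algebra.smul_def, Algebra.smul_def]
    change g (algebraMap K Ω a * r) = algebraMap K Ω a * g r
    rw [map_mul, g.commutes])⟩
  -- With the discrete topology on `R` the action is continuous, because every element of `Ω` has an
  -- open stabilizer. The profinite theorem on decomposition groups then applies to the maximal
  -- ideal, whose stabilizer surjects onto the residue automorphisms.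
  let _ : TopologicalSpace R := ⊥
  have : DiscreteTopology R := ⟨rfl⟩
  have : ContinuousSMul Gal(Ω/K) R := by
    have halg : Algebra.IsIntegral K Ω := inferInstance
    refine continuousSMul_iff_stabilizer_isOpen.2 fun r => ?_
    convert stabilizer_isOpen_of_isIntegral (K := K) (r : Ω) using 1
    ext g
    exact Subtype.ext_iff
  have : Algebra.IsInvariant O R Gal(Ω/K) := by
    constructor
    intro b hb
    obtain ⟨a, ha⟩ := (InfiniteGalois.mem_range_algebraMap_iff_fixed (k := K) (b : Ω)).2
      fun g => congrArg Subtype.val (hb g)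
    refine ⟨⟨a, ?_⟩, Subtype.ext ha⟩
    have h1 := hR.le b.2
    rw [← ha] at h1
    rw [← hO.integersIn_self]
    exact (isIntegral_algebraMap_iff (algebraMap K Ω).injective).1 h1
  let m := IsLocalRing.maximalIdeal R
  let P : Ideal O := m.under O
  have : m.LiesOver P := ⟨rfl⟩
  let τ' : (R ⧸ m) ≃ₐ[O ⧸ P] (R ⧸ m) := AlgEquiv.ofRingEquiv (f := τ) (by
    intro x
    obtain ⟨a, rfl⟩ := Ideal.Quotient.mk_surjective x
    exact hτ a (f a) rfl)
  obtain ⟨g, hg⟩ := Ideal.Quotient.stabilizerHom_surjective_of_profinite (G := Gal(Ω/K)) P m τ'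
  refine ⟨g, fun r s hs => ?_⟩
  have : s = g.1 • r := Subtype.ext hs
  rw [this]
  exact DFunLike.congr_fun hg (Ideal.Quotient.mk m r)

end Profinite

section ResidueField

variable {K Ω : Type u} [Field K] [Field Ω] [Algebra K Ω]

/-- The action of the Galois group on the ring of integers. -/
abbrev integersAction (O : Subring K) : MulSemiringAction Gal(Ω/K) (integersIn O Ω) where
  smul := fun g r => ⟨g r, map_mem_integersIn O g r.2⟩
  one_smul := fun _ => rfl
  mul_smul := fun _ _ _ => rfl
  smul_zero := fun g => Subtype.ext (map_zero g)
  smul_add := fun g _ _ => Subtype.ext (map_add g _ _)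
  smul_one := fun g => Subtype.ext (map_one g)
  smul_mul := fun g _ _ => Subtype.ext (map_mul g _ _)

theorem mem_inertia_iff (O : Subring K) [IsLocalRing (integersIn O Ω)] (g : Gal(Ω/K)) :
    g ∈ inertia O Ω ↔ ∀ r s : integersIn O Ω, (s : Ω) = g r →
      IsLocalRing.residue _ s = IsLocalRing.residue _ r := by
  change (∀ x ∈ integersIn O Ω, ∃ m ∈ Ideal.jacobson (⊥ : Ideal (integersIn O Ω)),
    (m : Ω) = g x - x) ↔ _
  rw [IsLocalRing.jacobson_eq_maximalIdeal _ bot_ne_top]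
  constructor
  · intro h r s hs
    obtain ⟨m, hm, h⟩ := h r r.2
    have : m = s - r := Subtype.ext (by rw [h, ← hs]; rfl)
    rw [this] at hm
    exact Ideal.Quotient.eq.2 hm
  · intro h x hx
    refine ⟨⟨g x, map_mem_integersIn O g hx⟩ - ⟨x, hx⟩, ?_, rfl⟩
    exact Ideal.Quotient.eq.1 (h ⟨x, hx⟩ ⟨g x, map_mem_integersIn O g hx⟩ rfl)

instance inertia_normal (O : Subring K) : (inertia O Ω).Normal := by
  constructor
  intro i hi g x hx
  obtain ⟨m, hm, h⟩ := hi (g⁻¹ x) (map_mem_integersIn O g⁻¹ hx)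
  let _ := integersAction (Ω := Ω) O
  refine ⟨g • m, ?_, ?_⟩
  · let e : integersIn O Ω ≃+* integersIn O Ω := MulSemiringAction.toRingEquiv _ _ g
    have := Ideal.map_jacobson_of_bijective (I := (⊥ : Ideal (integersIn O Ω))) (f := (e : integersIn O Ω →+* integersIn O Ω)) e.bijective
    rw [Ideal.map_bot] at this
    rw [← this]
    exact Ideal.mem_map_of_mem (e : integersIn O Ω →+* integersIn O Ω) hm
  · change g m = _
    rw [h, map_sub]
    have : g (g⁻¹ x) = x := g.apply_symm_apply x
    rw [this]; rfl

/-- Each element generates a finite field, which is Galois over `k`, so its minimal polynomial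
splits there; separability is automatic since finite fields are perfect. -/
theorem isGalois_of_finite_of_isAlgebraic (k E : Type*) [Field k] [Finite k] [Field E] [Algebra k E]
    [Algebra.IsAlgebraic k E] : IsGalois k E := by
  have : Normal k E := by
    refine ⟨fun x => ?_⟩
    have hx : IsIntegral k x := Algebra.IsIntegral.isIntegral x
    have : FiniteDimensional k (IntermediateField.adjoin k {x}) :=
      IntermediateField.adjoin.finiteDimensional hx
    have : Finite (IntermediateField.adjoin k {x}) := Module.finite_of_finite k
    have : IsGalois k (IntermediateField.adjoin k {x}) := inferInstance
    have h := this.to_normal.splits (IntermediateField.AdjoinSimple.gen k x)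
    rw [IntermediateField.minpoly_gen] at h
    have h2 := h.map (algebraMap (IntermediateField.adjoin k {x}) E)
    rwa [Polynomial.map_map, ← IsScalarTower.algebraMap_eq] at h2
  constructor

/-- The inclusion of the ring of integers of `K` into that of an extension. -/
def toIntegers {O : Subring K} {R : Subring Ω} (hR : R = integersIn O Ω) : O →+* R :=
  ((algebraMap K Ω).comp O.subtype).codRestrict R
    fun y => hR.symm.le (isIntegral_algebraMap (A := Ω) (x := y))

/-- If `a` becomes a unit, its inverse is an element of `K` integral over `O`, and `O` is integrally
closed in `K`. -/
theorem isLocalHom_toIntegers {O : Subring K} (hO : IsLocalField K O) {R : Subring Ω}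
    (hR : R = integersIn O Ω) : IsLocalHom (toIntegers hR) := by
  constructor
  intro a ha
  obtain ⟨b, hb⟩ := ha.exists_right_inv
  have hb' : algebraMap K Ω a * b = 1 := congrArg Subtype.val hb
  have ha0 : (a : K) ≠ 0 := by
    intro h; rw [h] at hb'; simp at hb'
  have hbi : (b : Ω) = algebraMap K Ω (a : K)⁻¹ := by
    rw [map_inv₀]; exact eq_inv_of_mul_eq_one_right hb'
  have : (a : K)⁻¹ ∈ O := by
    have h1 := hR.le b.2
    rw [hbi] at h1
    exact hO.integersIn_self.le ((isIntegral_algebraMap_iff (algebraMap K Ω).injective).1 h1)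
  exact IsUnit.of_mul_eq_one ⟨_, this⟩ (Subtype.ext (mul_inv_cancel₀ ha0))

/-- The image of the residue field of `K` in the residue field of an extension. -/
def residueSubfield {O : Subring K} (hO : IsLocalField K O) {R : Subring Ω} [IsLocalRing R]
    (hR : R = integersIn O Ω) : Subfield (IsLocalRing.ResidueField R) :=
  have := hO.isLocalRing_self
  have := isLocalHom_toIntegers hO hR
  (IsLocalRing.ResidueField.map (toIntegers hR)).fieldRange

theorem mem_residueSubfield {O : Subring K} (hO : IsLocalField K O) {R : Subring Ω} [IsLocalRing R]
    (hR : R = integersIn O Ω) (x : IsLocalRing.ResidueField R) :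
    x ∈ residueSubfield hO hR ↔ ∃ a : O, IsLocalRing.residue R (toIntegers hR a) = x := by
  have := hO.isLocalRing_self
  have := isLocalHom_toIntegers hO hR
  constructor
  · rintro ⟨y, rfl⟩
    obtain ⟨a, rfl⟩ := IsLocalRing.residue_surjective y
    exact ⟨a, rfl⟩
  · rintro ⟨a, rfl⟩
    exact ⟨IsLocalRing.residue O a, rfl⟩

theorem card_residueSubfield {O : Subring K} (hO : IsLocalField K O) {R : Subring Ω} [IsLocalRing R]
    (hR : R = integersIn O Ω) : Nat.card (residueSubfield hO hR) = residueCard O := by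
  have := hO.isLocalRing_self
  have := isLocalHom_toIntegers hO hR
  rw [residueCard, IsLocalRing.jacobson_eq_maximalIdeal _ bot_ne_top]
  exact Nat.card_congr (Equiv.ofInjective _
    (IsLocalRing.ResidueField.map (toIntegers hR)).injective).symm

theorem finite_residueSubfield {O : Subring K} (hO : IsLocalField K O) {R : Subring Ω}
    [IsLocalRing R] (hR : R = integersIn O Ω) : Finite (residueSubfield hO hR) := by
  apply Nat.finite_of_card_ne_zero
  rw [card_residueSubfield]
  exact (residueCard_pos hO).ne'

theorem isAlgebraic_residueSubfield {O : Subring K} (hO : IsLocalField K O) {R : Subring Ω}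
    [IsLocalRing R] (hR : R = integersIn O Ω) :
    Algebra.IsAlgebraic (residueSubfield hO hR) (IsLocalRing.ResidueField R) := by
  have : Algebra.IsIntegral (residueSubfield hO hR) (IsLocalRing.ResidueField R) := by
    constructor
    intro x
    obtain ⟨r, rfl⟩ := IsLocalRing.residue_surjective x
    obtain ⟨p, hp, h⟩ := hR.le r.2
    let f : O →+* residueSubfield hO hR :=
      ((IsLocalRing.residue R).comp (toIntegers hR)).codRestrict _
        fun a => (mem_residueSubfield hO hR _).2 ⟨a, rfl⟩
    refine ⟨p.map f, hp.map f, ?_⟩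
    have h1 : p.eval₂ (toIntegers hR) r = 0 := by
      apply Subtype.val_injective
      have := Polynomial.hom_eval₂ p (toIntegers hR) R.subtype r
      exact this.trans h
    rw [Polynomial.eval₂_map]
    have := Polynomial.hom_eval₂ p (toIntegers hR) (IsLocalRing.residue R) r
    rw [h1, map_zero] at this
    exact this.symm
  infer_instance

/-- The residue field degree of a finite extension in terms of Galois groups. -/
theorem residueCard_extension [IsSepClosure K Ω] {O : Subring K} (hO : IsLocalField K O)
    (L : IntermediateField K Ω) [FiniteDimensional K L] :
    residueCard (integersIn O L) =
      residueCard O ^ (inertia O Ω ⊔ L.fixingSubgroup).index := by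
  have hlocR := hO.isLocalRing Ω
  have hL := hO.extension L
  have hRL := (integersIn_integersIn O L).symm
  let R := integersIn O Ω
  let κ := IsLocalRing.ResidueField R
  let EL : Subfield κ := residueSubfield hL hRL
  let EO : Subfield κ := residueSubfield hO rfl
  have hle : EO ≤ EL := by
    intro x hx
    obtain ⟨a, rfl⟩ := (mem_residueSubfield hO rfl x).1 hx
    exact (mem_residueSubfield hL hRL _).2
      ⟨⟨algebraMap K L a, isIntegral_algebraMap (A := L) (x := a)⟩, rfl⟩
  let E : IntermediateField EO κ := Subfield.extendScalars hle
  have : Finite EO := finite_residueSubfield hO rfl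
  have : Finite E := finite_residueSubfield hL hRL
  have : Algebra.IsAlgebraic EO κ := isAlgebraic_residueSubfield hO rfl
  have : IsGalois EO κ := isGalois_of_finite_of_isAlgebraic _ _
  have : Module.Finite EO E := inferInstance
  let _ := integersAction (Ω := Ω) O
  have hsmul (g : Gal(Ω/K)) (r : R) :
    g • IsLocalRing.residue R r = IsLocalRing.residue R (g • r) := rfl
  have : SMulCommClass Gal(Ω/K) EO κ := by
    constructor
    intro g a x
    obtain ⟨b, hb⟩ := (mem_residueSubfield hO rfl _).1 a.2
    rw [Algebra.smul_def, Algebra.smul_def, smul_mul']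
    congr 1
    change g • (a : κ) = a
    rw [← hb, hsmul]
    congr 1
    exact Subtype.ext (g.commutes _)
  let θ : Gal(Ω/K) →* Gal(κ/EO) := MulSemiringAction.toAlgAut _ _ _
  have hθ (g : Gal(Ω/K)) (r : R) :
    θ g (IsLocalRing.residue R r) = IsLocalRing.residue R (g • r) := rfl
  have hker (g : Gal(Ω/K)) : g ∈ inertia O Ω ↔ θ g = 1 := by
    rw [mem_inertia_iff]
    constructor
    · intro h
      ext x
      obtain ⟨r, rfl⟩ := IsLocalRing.residue_surjective x
      exact h r (g • r) rfl
    · intro h r s hs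
      have : s = g • r := Subtype.ext hs
      rw [this, ← hθ, h]; rfl
  have hsurj : Function.Surjective θ := by
    intro τ
    obtain ⟨g, hg⟩ := exists_galois_lift hO R rfl τ.toRingEquiv (by
      intro a r hr
      exact τ.commutes ⟨_, (mem_residueSubfield hO rfl _).2 ⟨a, congrArg _ (Subtype.ext hr.symm)⟩⟩)
    refine ⟨g, ?_⟩
    ext x
    obtain ⟨r, rfl⟩ := IsLocalRing.residue_surjective x
    exact hg r (g • r) rfl
  have hfix (h : Gal(Ω/K)) (hh : h ∈ L.fixingSubgroup) : θ h ∈ E.fixingSubgroup := by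
    rw [IntermediateField.mem_fixingSubgroup_iff]
    intro x hx
    obtain ⟨a, rfl⟩ := (mem_residueSubfield hL hRL x).1 hx
    rw [hθ]
    congr 1
    exact Subtype.ext ((IntermediateField.mem_fixingSubgroup_iff _ _).1 hh _ (a : L).2)
  have hcomap : E.fixingSubgroup.comap θ = inertia O Ω ⊔ L.fixingSubgroup := by
    apply le_antisymm
    · intro g hg
      -- The residue automorphism `θ g` fixes the residue field of `L`, so some element of
      -- `Gal(Ω/L)` induces it too. The quotient of `g` by that element is in the inertia group.
      obtain ⟨h, hh⟩ := exists_galois_lift hL R hRL (θ g).toRingEquiv (by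
        intro a r hr
        refine (IntermediateField.mem_fixingSubgroup_iff _ _).1 hg _
          ((mem_residueSubfield hL hRL _).2 ⟨a, congrArg _ (Subtype.ext hr.symm)⟩))
      have h1 : θ (galRes L h) = θ g := by
        ext x
        obtain ⟨r, rfl⟩ := IsLocalRing.residue_surjective x
        exact hh r (galRes L h • r) rfl
      have h2 : g * (galRes L h)⁻¹ ∈ inertia O Ω := by
        rw [hker, map_mul, map_inv, h1, mul_inv_cancel]
      have h3 : galRes L h ∈ L.fixingSubgroup := by
        rw [IntermediateField.mem_fixingSubgroup_iff]
        exact fun x hx => h.commutes ⟨x, hx⟩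
      simpa using mul_mem (le_sup_left (b := L.fixingSubgroup) h2)
        (le_sup_right (a := inertia O Ω) h3)
    · refine sup_le (fun g hg => ?_) (fun g hg => hfix g hg)
      rw [Subgroup.mem_comap, (hker g).1 hg]
      exact one_mem _
  -- As `θ` is surjective, the index of `I · G_L` is that of the fixing subgroup of `E`, which is
  -- the degree of the extension of finite residue fields.
  rw [← card_residueSubfield hL hRL, ← card_residueSubfield (Ω := Ω) hO rfl, ← hcomap,
    Subgroup.index_comap_of_surjective _ hsurj,
    ← IntermediateField.finrank_eq_fixingSubgroup_index, ← Module.natCard_eq_pow_finrank]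
  rfl

end ResidueField

/-! ### Orbit symbols as subgroup indices -/

section Index

/-- The orbit–stabilizer count for an arbitrary map whose fibres are the left cosets of `H`. It
serves for orbits of points and for sets of inertia orbits; if the index is infinite, both sides are
0. -/
theorem ncard_range_eq_index {G Z : Type*} [Group G] (H : Subgroup G) (f : G → Z)
    (h : ∀ a b, f a = f b ↔ a⁻¹ * b ∈ H) : (Set.range f).ncard = H.index := by
  let F : G ⧸ H → Z := Quotient.lift f fun a b hab => (h a b).2 (QuotientGroup.leftRel_apply.1 hab)
  have hF : Function.Injective F := by
    rintro ⟨a⟩ ⟨b⟩ hab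
    exact QuotientGroup.eq.2 ((h a b).1 hab)
  have : Set.range f = Set.range F := (Set.range_quot_lift _).symm
  rw [this, Subgroup.index, Nat.card_congr (Equiv.ofInjective F hF), Nat.card_coe_set_eq]

/-- Second isomorphism theorem: every coset of `H` in `IH` has a representative in `I`. -/
theorem relIndex_sup_of_normal {G : Type*} [Group G] (I H : Subgroup G) [I.Normal] :
    H.relIndex (I ⊔ H) = H.relIndex I := by
  symm
  refine Nat.card_congr (Equiv.ofBijective
    (Subgroup.quotientSubgroupOfEmbeddingOfLE H (le_sup_left : I ≤ I ⊔ H)) ⟨Function.Embedding.injective _, ?_⟩)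
  rintro ⟨⟨g, hg⟩⟩
  obtain ⟨i, hi, h, hh, rfl⟩ := Subgroup.mem_sup_of_normal_left.1 hg
  refine ⟨QuotientGroup.mk ⟨i, hi⟩, ?_⟩
  refine QuotientGroup.eq.2 ?_
  rw [Subgroup.mem_subgroupOf]
  simpa using hh

theorem index_sup_mul_relIndex {G : Type*} [Group G] (I H : Subgroup G) [I.Normal] :
    (I ⊔ H).index * H.relIndex I = H.index := by
  rw [← relIndex_sup_of_normal, mul_comm, Subgroup.relIndex_mul_index le_sup_right]

end Index

section Symbols

variable {K Ω : Type u} [Field K] [Field Ω] [Algebra K Ω] {Γ X : Type*} [Group Γ] [MulAction Γ X]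

theorem Rep.mem_stab {ρ : Rep K Ω Γ} {x : X} {g : Gal(Ω/K)} : g ∈ ρ.stab x ↔ ρ.1 g • x = x :=
  Iff.rfl

theorem Rep.mem_orbit_range {ρ : Rep K Ω Γ} {x y : X} :
    y ∈ MulAction.orbit ρ.1.range x ↔ ∃ g, ρ.1 g • x = y := by
  constructor
  · rintro ⟨⟨_, g, rfl⟩, h⟩
    exact ⟨g, h⟩
  · rintro ⟨g, h⟩
    exact ⟨⟨_, g, rfl⟩, h⟩

theorem mem_orbit_map {G : Type*} [Group G] {r : G →* Γ} {I : Subgroup G} {x y : X} :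
    y ∈ MulAction.orbit (I.map r) x ↔ ∃ g ∈ I, r g • x = y := by
  constructor
  · rintro ⟨⟨_, g, hg, rfl⟩, h⟩
    exact ⟨g, hg, h⟩
  · rintro ⟨g, hg, h⟩
    exact ⟨⟨_, g, hg, rfl⟩, h⟩

theorem symbolAt_snd (O : Subring K) (ρ : Rep K Ω Γ) (x : X) :
    (symbolAt O ρ x).2 = (ρ.stab x).relIndex (inertia O Ω) := by
  have : MulAction.orbit ((inertia O Ω).map ρ.1) x =
      Set.range fun g : inertia O Ω => ρ.1 g • x := by
    ext y
    rw [mem_orbit_map]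
    simp
  change (MulAction.orbit ((inertia O Ω).map ρ.1) x).ncard = _
  rw [this]
  apply ncard_range_eq_index
  intro a b
  rw [Subgroup.mem_subgroupOf, Rep.mem_stab, eq_comm]
  simp [mul_smul, inv_smul_eq_iff]

/-- Since inertia is normal, `a x` and `b x` are in the same inertia orbit exactly when `a⁻¹ b` lies
in the product of inertia and the stabilizer of `x`. With `symbolAt_snd`, this shows that the symbol
depends only on the stabilizer. -/
theorem symbolAt_fst (O : Subring K) (ρ : Rep K Ω Γ) (x : X) :
    (symbolAt O ρ x).1 = (inertia O Ω ⊔ ρ.stab x).index := by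
  have : (fun y : X => MulAction.orbit ((inertia O Ω).map ρ.1) y) ''
      (MulAction.orbit ρ.1.range x) =
      Set.range fun g : Gal(Ω/K) => MulAction.orbit ((inertia O Ω).map ρ.1) (ρ.1 g • x) := by
    ext y
    simp only [Set.mem_image, Rep.mem_orbit_range, Set.mem_range]
    constructor
    · rintro ⟨_, ⟨g, rfl⟩, h⟩
      exact ⟨g, h⟩
    · rintro ⟨g, h⟩
      exact ⟨_, ⟨g, rfl⟩, h⟩
  change (_ '' _).ncard = _
  rw [this]
  apply ncard_range_eq_index
  intro a b
  rw [MulAction.orbit_eq_iff, mem_orbit_map, Subgroup.mem_sup_of_normal_left]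
  constructor
  · rintro ⟨i, hi, h⟩
    refine ⟨a⁻¹ * i⁻¹ * a, by simpa using (inertia_normal O).conj_mem _ (inv_mem hi) a⁻¹,
      a⁻¹ * i * b, ?_, by group⟩
    rw [Rep.mem_stab, map_mul, map_mul, map_inv, mul_smul, mul_smul, h, inv_smul_smul]
  · rintro ⟨i, hi, s, hs, h⟩
    refine ⟨a * i⁻¹ * a⁻¹, (inertia_normal O).conj_mem _ (inv_mem hi) a, ?_⟩
    have hb : b = a * i * s := by rw [mul_assoc, h]; group
    rw [Rep.mem_stab] at hs
    rw [hb]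
    simp [mul_smul, hs]

theorem symbolAt_mul (O : Subring K) (ρ : Rep K Ω Γ) (x : X) :
    (symbolAt O ρ x).1 * (symbolAt O ρ x).2 = (ρ.stab x).index := by
  rw [symbolAt_fst, symbolAt_snd, index_sup_mul_relIndex]

theorem ncard_orbit_eq_index_stab (ρ : Rep K Ω Γ) (x : X) :
    (Set.range fun g : Gal(Ω/K) => ρ.1 g • x).ncard = (ρ.stab x).index := by
  apply ncard_range_eq_index
  intro a b
  rw [Rep.mem_stab, eq_comm]
  simp [mul_smul, inv_smul_eq_iff]

theorem index_stab_pos [Finite X] (ρ : Rep K Ω Γ) (x : X) : 0 < (ρ.stab x).index := by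
  rw [← ncard_orbit_eq_index_stab, Set.ncard_pos]
  exact Set.range_nonempty _

theorem symbolAt_fst_pos [Finite X] (O : Subring K) (ρ : Rep K Ω Γ) (x : X) :
    0 < (symbolAt O ρ x).1 :=
  Nat.pos_of_ne_zero fun h => by
    have := index_stab_pos ρ x
    rw [← symbolAt_mul O, h, zero_mul] at this
    exact this.false

theorem symbolAt_snd_pos [Finite X] (O : Subring K) (ρ : Rep K Ω Γ) (x : X) :
    0 < (symbolAt O ρ x).2 :=
  Nat.pos_of_ne_zero fun h => by
    have := index_stab_pos ρ x
    rw [← symbolAt_mul O, h, mul_zero] at this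
    exact this.false

end Symbols

/-! ### Transport along isomorphisms of fields -/

section Transport

variable {K Ω : Type u} [Field K] [Field Ω] [Algebra K Ω]
  {K' Ω' : Type u} [Field K'] [Field Ω'] [Algebra K' Ω']

/-- The isomorphism of Galois groups induced by an isomorphism of extensions. -/
def galConj (e : K ≃+* K') (E : Ω ≃+* Ω')
    (hE : ∀ x : K, E (algebraMap K Ω x) = algebraMap K' Ω' (e x)) : Gal(Ω/K) ≃* Gal(Ω'/K') where
  toFun g := AlgEquiv.ofRingEquiv (f := E.symm.trans (g.toRingEquiv.trans E)) (by
    intro x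
    obtain ⟨y, rfl⟩ := e.surjective x
    simp [← hE])
  invFun g := AlgEquiv.ofRingEquiv (f := E.trans (g.toRingEquiv.trans E.symm)) (by
    intro x
    simp [hE, RingEquiv.symm_apply_eq])
  left_inv g := by ext; simp
  right_inv g := by ext; simp
  map_mul' g h := by ext; simp

theorem galConj_apply (e : K ≃+* K') (E : Ω ≃+* Ω')
    (hE : ∀ x : K, E (algebraMap K Ω x) = algebraMap K' Ω' (e x)) (g : Gal(Ω/K)) (x : Ω) :
    galConj e E hE g (E x) = E (g x) := by
  simp [galConj]

theorem eq_galConj (e : K ≃+* K') (E : Ω ≃+* Ω')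
    (hE : ∀ x : K, E (algebraMap K Ω x) = algebraMap K' Ω' (e x)) (g : Gal(Ω/K)) (g' : Gal(Ω'/K'))
    (h : ∀ x, E (g x) = g' (E x)) : g' = galConj e E hE g := by
  ext y
  obtain ⟨x, rfl⟩ := E.surjective y
  rw [galConj_apply, h]

theorem map_mem_integersIn_of_equiv {O : Subring K} {O' : Subring K'} (e : K ≃+* K') (E : Ω ≃+* Ω')
    (hO : O.map (e : K →+* K') = O')
    (hE : ∀ x : K, E (algebraMap K Ω x) = algebraMap K' Ω' (e x)) {x : Ω}
    (hx : x ∈ integersIn O Ω) : E x ∈ integersIn O' Ω' := by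
  let f : O →+* O' := ((e : K →+* K').comp O.subtype).codRestrict O'
    fun y => hO.le (Subring.mem_map.2 ⟨y, y.2, rfl⟩)
  have hx : IsIntegral O x := hx
  exact hx.map_of_comp_eq f (E : Ω →+* Ω') (RingHom.ext fun y => (hE y).symm)

theorem symm_compat {e : K ≃+* K'} {E : Ω ≃+* Ω'}
    (hE : ∀ x : K, E (algebraMap K Ω x) = algebraMap K' Ω' (e x)) (x : K') :
    E.symm (algebraMap K' Ω' x) = algebraMap K Ω (e.symm x) := by
  obtain ⟨y, rfl⟩ := e.surjective x
  simp [← hE]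

theorem map_symm_eq {O : Subring K} {O' : Subring K'} {e : K ≃+* K'}
    (hO : O.map (e : K →+* K') = O') : O'.map (e.symm : K' →+* K) = O := by
  subst hO
  ext x
  simp [Subring.mem_map]

theorem mem_integersIn_equiv {O : Subring K} {O' : Subring K'} (e : K ≃+* K') (E : Ω ≃+* Ω')
    (hO : O.map (e : K →+* K') = O')
    (hE : ∀ x : K, E (algebraMap K Ω x) = algebraMap K' Ω' (e x)) (x : Ω) :
    E x ∈ integersIn O' Ω' ↔ x ∈ integersIn O Ω := by
  refine ⟨fun h => ?_, map_mem_integersIn_of_equiv e E hO hE⟩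
  simpa using map_mem_integersIn_of_equiv e.symm E.symm (map_symm_eq hO) (symm_compat hE) h

theorem galConj_mem_inertia {O : Subring K} {O' : Subring K'} (e : K ≃+* K') (E : Ω ≃+* Ω')
    (hO : O.map (e : K →+* K') = O')
    (hE : ∀ x : K, E (algebraMap K Ω x) = algebraMap K' Ω' (e x)) (g : Gal(Ω/K))
    (hg : g ∈ inertia O Ω) : galConj e E hE g ∈ inertia O' Ω' := by
  intro y hy
  obtain ⟨x, rfl⟩ := E.surjective y
  rw [mem_integersIn_equiv e E hO hE] at hy
  obtain ⟨m, hm, h⟩ := hg x hy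
  let ER : integersIn O Ω ≃+* integersIn O' Ω' :=
    E.restrict (integersIn O Ω) (integersIn O' Ω') fun x => (mem_integersIn_equiv e E hO hE x).symm
  refine ⟨ER m, ?_, ?_⟩
  · have := Ideal.map_jacobson_of_bijective (I := (⊥ : Ideal (integersIn O Ω)))
      (f := (ER : integersIn O Ω →+* integersIn O' Ω')) ER.bijective
    rw [Ideal.map_bot] at this
    rw [← this]
    exact Ideal.mem_map_of_mem (ER : integersIn O Ω →+* integersIn O' Ω') hm
  · change E m = _
    rw [h, galConj_apply, map_sub]

theorem map_inertia {O : Subring K} {O' : Subring K'} (e : K ≃+* K') (E : Ω ≃+* Ω')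
    (hO : O.map (e : K →+* K') = O')
    (hE : ∀ x : K, E (algebraMap K Ω x) = algebraMap K' Ω' (e x)) :
    (inertia O Ω).map (galConj e E hE : Gal(Ω/K) →* Gal(Ω'/K')) = inertia O' Ω' := by
  ext g'
  rw [Subgroup.mem_map]
  constructor
  · rintro ⟨g, hg, rfl⟩
    exact galConj_mem_inertia e E hO hE g hg
  · intro h
    have := galConj_mem_inertia e.symm E.symm (map_symm_eq hO) (symm_compat hE) g' h
    refine ⟨_, this, ?_⟩
    symm
    apply eq_galConj
    intro x
    obtain ⟨y, rfl⟩ := E.symm.surjective x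
    rw [galConj_apply]
    simp

variable {Γ X : Type*} [Group Γ] [MulAction Γ X]

theorem Rep.map_stab (θ : Gal(Ω/K) ≃* Gal(Ω'/K')) (ρ : Rep K Ω Γ) (ρ' : Rep K' Ω' Γ) (γ : Γ)
    (h : ∀ g, ρ'.1 (θ g) = γ * ρ.1 g * γ⁻¹) (x : X) :
    (ρ.stab x).map (θ : Gal(Ω/K) →* Gal(Ω'/K')) = ρ'.stab (γ • x) := by
  ext g'
  obtain ⟨g, rfl⟩ := θ.surjective g'
  have : θ g ∈ (ρ.stab x).map (θ : Gal(Ω/K) →* Gal(Ω'/K')) ↔ g ∈ ρ.stab x := by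
    simp [Subgroup.mem_map]
  rw [this, Rep.mem_stab, Rep.mem_stab, h]
  simp [mul_smul]

/-- The isomorphism of Galois groups matches the inertia groups, and the stabilizer of `x` with that
of `γ • x`; the symbol is built from indices. Allowing both an isomorphism and a conjugation by `γ`
also covers moving a point within its orbit. -/
theorem symbolAt_transport {O : Subring K} {O' : Subring K'} (e : K ≃+* K') (E : Ω ≃+* Ω')
    (hO : O.map (e : K →+* K') = O')
    (hE : ∀ x : K, E (algebraMap K Ω x) = algebraMap K' Ω' (e x)) (ρ : Rep K Ω Γ)
    (ρ' : Rep K' Ω' Γ) (γ : Γ) (h : ∀ g, ρ'.1 (galConj e E hE g) = γ * ρ.1 g * γ⁻¹) (x : X) :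
    symbolAt O' ρ' (γ • x) = symbolAt O ρ x := by
  have h1 := map_inertia e E hO hE
  have h2 := Rep.map_stab (galConj e E hE) ρ ρ' γ h x
  apply Prod.ext
  · rw [symbolAt_fst, symbolAt_fst, ← h1, ← h2, ← Subgroup.map_sup]
    exact Subgroup.index_map_equiv _ _
  · rw [symbolAt_snd, symbolAt_snd, ← h1, ← h2]
    exact Subgroup.relIndex_map_map_of_injective _ _ (galConj e E hE).injective

theorem Rep.mem_pointField {ρ : Rep K Ω Γ} {j : X} {x : Ω} :
    x ∈ ρ.pointField j ↔ ∀ g ∈ ρ.stab j, g x = x :=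
  ⟨fun h g hg => h ⟨g, hg⟩, fun h g => h g g.2⟩

theorem Rep.mem_pointField_transport (e : K ≃+* K') (E : Ω ≃+* Ω')
    (hE : ∀ x : K, E (algebraMap K Ω x) = algebraMap K' Ω' (e x)) (ρ : Rep K Ω Γ)
    (ρ' : Rep K' Ω' Γ) (γ : Γ) (h : ∀ g, ρ'.1 (galConj e E hE g) = γ * ρ.1 g * γ⁻¹) (j : X)
    (x : Ω) : x ∈ ρ.pointField j ↔ E x ∈ ρ'.pointField (γ • j) := by
  rw [Rep.mem_pointField, Rep.mem_pointField, ← Rep.map_stab (galConj e E hE) ρ ρ' γ h j]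
  constructor
  · rintro H _ ⟨g, hg, rfl⟩
    change galConj e E hE g (E x) = E x
    rw [galConj_apply, H g hg]
  · intro H g hg
    have := H _ ⟨g, hg, rfl⟩
    change galConj e E hE g (E x) = E x at this
    rw [galConj_apply] at this
    exact E.injective this

theorem symbolAt_smul (O : Subring K) (ρ : Rep K Ω Γ) (g : Gal(Ω/K)) (x : X) :
    symbolAt O ρ (ρ.1 g • x) = symbolAt O ρ x := by
  -- Here `g` itself plays the role of the isomorphism of `Ω`, so that `galConj` is conjugation by
  -- `g` and `γ` is `ρ g`.
  apply symbolAt_transport (RingEquiv.refl K) g.toRingEquiv (by ext; simp) (fun x => g.commutes x)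
  intro h
  rw [← map_inv, ← map_mul, ← map_mul]
  congr 1

theorem symbolAt_eq_of_mem_orbit (O : Subring K) (ρ : Rep K Ω Γ) {x y : X}
    (h : y ∈ MulAction.orbit ρ.1.range x) : symbolAt O ρ y = symbolAt O ρ x := by
  obtain ⟨g, rfl⟩ := Rep.mem_orbit_range.1 h
  exact symbolAt_smul O ρ g x

end Transport

/-! ### Canonical orbit representatives -/

section OrbitReps

variable {K Ω : Type u} [Field K] [Field Ω] [Algebra K Ω]
variable {B Y : Type*} [Group B] [MulAction B Y] [Fintype Y] [LinearOrder Y]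

theorem mem_orbitReps {φ : Rep K Ω B} {j : Y} :
    j ∈ orbitReps φ ↔ ∀ k ∈ MulAction.orbit φ.1.range j, j ≤ k := by
  classical
  simp [orbitReps]

theorem nodup_orbitReps (φ : Rep K Ω B) : (orbitReps φ : List Y).Nodup :=
  Finset.sort_nodup _ _

theorem exists_mem_orbitReps (φ : Rep K Ω B) (j : Y) :
    ∃ i ∈ orbitReps φ, j ∈ MulAction.orbit φ.1.range i := by
  classical
  let s : Finset Y := Finset.univ.filter fun k => k ∈ MulAction.orbit φ.1.range j
  have hs : s.Nonempty := ⟨j, by simp [s, MulAction.mem_orbit_self]⟩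
  have hm : s.min' hs ∈ MulAction.orbit φ.1.range j := by
    simpa [s] using s.min'_mem hs
  refine ⟨s.min' hs, mem_orbitReps.2 fun k hk => ?_, MulAction.mem_orbit_symm.1 hm⟩
  rw [MulAction.orbit_eq_iff.2 hm] at hk
  exact s.min'_le _ (by simpa [s] using hk)

theorem orbitReps_unique (φ : Rep K Ω B) {i j : Y} (hi : i ∈ orbitReps φ) (hj : j ∈ orbitReps φ)
    (h : j ∈ MulAction.orbit φ.1.range i) : i = j :=
  le_antisymm (mem_orbitReps.1 hi j h) (mem_orbitReps.1 hj i (MulAction.mem_orbit_symm.1 h))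

/-- The canonical representative of the orbit of `j`. -/
def repOf (φ : Rep K Ω B) (j : Y) : Y := (exists_mem_orbitReps φ j).choose

theorem repOf_mem (φ : Rep K Ω B) (j : Y) : repOf φ j ∈ orbitReps φ :=
  (exists_mem_orbitReps φ j).choose_spec.1

theorem mem_orbit_repOf (φ : Rep K Ω B) (j : Y) : j ∈ MulAction.orbit φ.1.range (repOf φ j) :=
  (exists_mem_orbitReps φ j).choose_spec.2

theorem repOf_eq_of_mem (φ : Rep K Ω B) {i j : Y} (hi : i ∈ orbitReps φ)
    (h : j ∈ MulAction.orbit φ.1.range i) : repOf φ j = i := by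
  symm
  apply orbitReps_unique φ hi (repOf_mem φ j)
  rw [← MulAction.orbit_eq_iff.2 h]
  exact MulAction.mem_orbit_symm.1 (mem_orbit_repOf φ j)

theorem repOf_of_mem (φ : Rep K Ω B) {i : Y} (hi : i ∈ orbitReps φ) : repOf φ i = i :=
  repOf_eq_of_mem φ hi (MulAction.mem_orbit_self _)

theorem repOf_smul (φ : Rep K Ω B) (g : Gal(Ω/K)) (j : Y) : repOf φ (φ.1 g • j) = repOf φ j := by
  apply repOf_eq_of_mem φ (repOf_mem φ j)
  rw [← MulAction.orbit_eq_iff.2 (mem_orbit_repOf φ j)]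
  exact Rep.mem_orbit_range.2 ⟨g, rfl⟩

theorem length_orbitReps_le (φ : Rep K Ω B) : (orbitReps φ : List Y).length ≤ Fintype.card Y :=
  (nodup_orbitReps φ).length_le_card

open Classical in
/-- A function that is constant on orbits, evaluated on representatives. -/
theorem map_orbitReps {α : Type*} (φ : Rep K Ω B) (F : Y → α)
    (hF : ∀ i j, j ∈ MulAction.orbit φ.1.range i → F j = F i) :
    (((orbitReps φ).map F : List α) : Multiset α) =
      (Finset.univ : Finset (MulAction.orbitRel.Quotient φ.1.range Y)).val.map
        (fun o => F o.out) := by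
  let e : {i : Y // i ∈ (orbitReps φ).toFinset} ≃ MulAction.orbitRel.Quotient φ.1.range Y :=
    { toFun := fun i => Quotient.mk (MulAction.orbitRel φ.1.range Y) i.1
      invFun := fun o => ⟨repOf φ o.out, by simpa using repOf_mem φ _⟩
      left_inv := by
        rintro ⟨i, hi⟩
        apply Subtype.ext
        apply repOf_eq_of_mem φ (by simpa using hi)
        exact Quotient.mk_out (s := MulAction.orbitRel φ.1.range Y) i
      right_inv := by
        intro o
        refine (Quotient.sound ?_).trans (Quotient.out_eq o)
        exact MulAction.mem_orbit_symm.1 (mem_orbit_repOf φ _) }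
  have h1 : ((orbitReps φ : List Y) : Multiset Y) = (orbitReps φ).toFinset.val := by
    rw [List.toFinset_val, (nodup_orbitReps φ).dedup]
  rw [← Multiset.map_coe, h1, ← Multiset.attach_map_val (orbitReps φ).toFinset.val,
    Multiset.map_map, ← Multiset.map_univ_val_equiv e, Multiset.map_map]
  change Multiset.map _ (Finset.univ : Finset {i : Y // i ∈ (orbitReps φ).toFinset}).val = _
  refine Multiset.map_congr rfl fun i _ => ?_
  exact (hF i.1 _ (Quotient.mk_out (s := MulAction.orbitRel φ.1.range Y) i.1)).symm

theorem repType_eq_map_orbitReps (O : Subring K) (φ : Rep K Ω B) :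
    repType Y O φ = (((orbitReps φ : List Y).map (symbolAt O φ) : List (ℕ × ℕ)) : Multiset _) :=
  (map_orbitReps φ _ fun _ _ h => symbolAt_eq_of_mem_orbit O φ h).symm

variable {K' Ω' : Type u} [Field K'] [Field Ω'] [Algebra K' Ω']

/-- The action of `b` need not respect the order on `Y`, so it need not carry least elements to
least elements. Since the functions are constant on orbits, the comparison can be made on the orbit
sets, which `b` identifies. -/
theorem map_orbitReps_transport {α : Type*} (φ : Rep K Ω B) (φ' : Rep K' Ω' B)
    (θ : Gal(Ω/K) ≃* Gal(Ω'/K')) (b : B) (h : ∀ g, φ'.1 (θ g) = b * φ.1 g * b⁻¹)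
    (F F' : Y → α) (hF' : ∀ i j, j ∈ MulAction.orbit φ'.1.range i → F' j = F' i)
    (hFF' : ∀ j, F' (b • j) = F j) :
    (((orbitReps φ').map F' : List α) : Multiset α) = ((orbitReps φ).map F : List α) := by
  classical
  have hb (i j : Y) : b • j ∈ MulAction.orbit φ'.1.range (b • i) ↔
      j ∈ MulAction.orbit φ.1.range i := by
    rw [Rep.mem_orbit_range, Rep.mem_orbit_range]
    refine (θ.surjective.exists (p := fun g => φ'.1 g • b • i = b • j)).trans ?_
    simp [h, mul_smul]
  have hF (i j : Y) (hij : j ∈ MulAction.orbit φ.1.range i) : F j = F i := by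
    rw [← hFF', ← hFF']
    exact hF' _ _ ((hb i j).2 hij)
  rw [map_orbitReps φ' F' hF', map_orbitReps φ F hF]
  let e : MulAction.orbitRel.Quotient φ.1.range Y ≃ MulAction.orbitRel.Quotient φ'.1.range Y :=
    Quotient.congr (MulAction.toPerm b) fun i j => (hb j i).symm
  rw [← Multiset.map_univ_val_equiv e, Multiset.map_map]
  refine Multiset.map_congr rfl fun o _ => ?_
  induction o using Quotient.inductionOn with
  | h i =>
    have h1 := hF i _ (Quotient.mk_out (s := MulAction.orbitRel φ.1.range Y) i)
    have h2 := hF' (b • i) _ (Quotient.mk_out (s := MulAction.orbitRel φ'.1.range Y) (b • i))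
    exact h2.trans ((hFF' i).trans h1.symm)

end OrbitReps

/-! ### Fixed fields of point stabilizers -/

section PointField

theorem Rep.stab_isOpen {K Ω Γ X : Type*} [Field K] [Field Ω] [Algebra K Ω] [Group Γ]
    [MulAction Γ X] (ρ : Rep K Ω Γ) (x : X) : IsOpen (ρ.stab x : Set Gal(Ω/K)) := by
  let _ : TopologicalSpace Γ := ⊥
  have : DiscreteTopology Γ := ⟨rfl⟩
  exact (isOpen_discrete (MulAction.stabilizer Γ x : Set Γ)).preimage ρ.2

variable {K Ω : Type u} [Field K] [Field Ω] [Algebra K Ω] [IsSepClosure K Ω]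
  {Γ X : Type*} [Group Γ] [MulAction Γ X]

theorem Rep.fixingSubgroup_pointField (ρ : Rep K Ω Γ) (x : X) :
    (ρ.pointField x).fixingSubgroup = ρ.stab x :=
  InfiniteGalois.fixingSubgroup_fixedField (k := K) (K := Ω) ⟨ρ.stab x, ρ.stab_isClosed x⟩

instance Rep.finiteDimensional_pointField (ρ : Rep K Ω Γ) (x : X) :
    FiniteDimensional K (ρ.pointField x) := by
  rw [← InfiniteGalois.isOpen_iff_finite]
  change IsOpen ((ρ.pointField x).fixingSubgroup : Set Gal(Ω/K))
  rw [ρ.fixingSubgroup_pointField]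
  exact ρ.stab_isOpen x

theorem residueCard_pointField {O : Subring K} (hO : IsLocalField K O) (ρ : Rep K Ω Γ) (x : X) :
    residueCard (integersIn O (ρ.pointField x)) = residueCard O ^ (symbolAt O ρ x).1 := by
  rw [residueCard_extension hO, ρ.fixingSubgroup_pointField, symbolAt_fst]

end PointField

/-! ### The counting function of a wreath product -/

section Wreath

variable {K Ω : Type u} [Field K] [Field Ω] [Algebra K Ω] [IsSepClosure K Ω]
  {K' Ω' : Type u} [Field K'] [Field Ω'] [Algebra K' Ω'] [IsSepClosure K' Ω']
  {A B Y : Type*} [Group A] [Group B] [MulAction B Y]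

theorem Wreath.mul_left_apply (v w : Wreath A B Y) (j : Y) :
    (v * w).left j = v.left j * w.left (v.right⁻¹ • j) := rfl

theorem Wreath.inv_left_apply (w : Wreath A B Y) (j : Y) :
    w⁻¹.left j = (w.left (w.right • j))⁻¹ := by
  have := Wreath.mul_left_apply w w⁻¹ (w.right • j)
  rw [mul_inv_cancel, inv_smul_smul] at this
  exact eq_inv_of_mul_eq_one_right this.symm

theorem Wreath.conj_left_apply (γ w : Wreath A B Y) (j : Y) (h : w.right • j = j) :
    (γ * w * γ⁻¹).left (γ.right • j) =
      γ.left (γ.right • j) * w.left j * (γ.left (γ.right • j))⁻¹ := by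
  rw [Wreath.mul_left_apply, Wreath.mul_left_apply, Wreath.inv_left_apply]
  have h1 : γ.right • (γ * w).right⁻¹ • γ.right • j = γ.right • j := by
    rw [SemidirectProduct.mul_right, mul_inv_rev, mul_smul, inv_smul_smul, inv_smul_eq_iff.2 h.symm]
  rw [h1, inv_smul_smul]

/-- The isomorphism `E` carries the fixed field at `j` onto the one at `γ.right • j`, and the two
point representations then differ by conjugation in `A`. Both axioms for `cA` enter. -/
theorem count_pointRep_transport {cA : RepFunction.{u} A} (hcA : IsCountingFunction cA)
    {O : Subring K} {O' : Subring K'} (hOl : IsLocalField K O) (hOl' : IsLocalField K' O')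
    (e : K ≃+* K') (E : Ω ≃+* Ω') (hO : O.map (e : K →+* K') = O')
    (hE : ∀ x : K, E (algebraMap K Ω x) = algebraMap K' Ω' (e x))
    (ρ : Rep K Ω (Wreath A B Y)) (ρ' : Rep K' Ω' (Wreath A B Y)) (γ : Wreath A B Y)
    (h : ∀ g, ρ'.1 (galConj e E hE g) = γ * ρ.1 g * γ⁻¹) (j j' : Y) (hj : j' = γ.right • j) :
    cA ((barRep ρ').pointField j') Ω' (integersIn O' _) (pointRep ρ' j') =
      cA ((barRep ρ).pointField j) Ω (integersIn O _) (pointRep ρ j) := by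
  subst hj
  have hbar (g) : (barRep ρ').1 (galConj e E hE g) = γ.right * (barRep ρ).1 g * γ.right⁻¹ := by
    change (ρ'.1 (galConj e E hE g)).right = _
    rw [h]; rfl
  have hmem := Rep.mem_pointField_transport e E hE (barRep ρ) (barRep ρ') γ.right hbar j
  let f : (barRep ρ).pointField j ≃+* (barRep ρ').pointField (γ.right • j) :=
    E.restrict ((barRep ρ).pointField j) ((barRep ρ').pointField (γ.right • j)) hmem
  -- The conjugating element is the component of `γ` at the target point, as in
  -- `Wreath.conj_left_apply`; that formula needs `j` to be fixed.
  rw [← hcA.conj_eq _ _ _ (hOl.extension _) (pointRep ρ j) (γ.left (γ.right • j))]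
  symm
  refine hcA.iso_eq _ _ _ _ _ _ (hOl.extension _) (hOl'.extension _) f E ?_ (fun x => rfl) _ _ ?_
  · ext y
    obtain ⟨x, rfl⟩ := f.surjective y
    rw [mem_integersIn_equiv e f hO (fun x => Subtype.ext (hE x))]
    rw [Subring.mem_map]
    constructor
    · rintro ⟨z, hz, hzx⟩
      rwa [← f.injective hzx]
    · intro hx
      exact ⟨x, hx, rfl⟩
  · intro g g' hg
    have h1 : galRes _ g' = galConj e E hE (galRes _ g) := eq_galConj e E hE _ _ hg
    change γ.left (γ.right • j) * (ρ.1 (galRes _ g)).left j * (γ.left (γ.right • j))⁻¹ =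
      (ρ'.1 (galRes _ g')).left (γ.right • j)
    rw [h1, h, Wreath.conj_left_apply]
    exact galRes_mem_stab (barRep ρ) j g

variable [Fintype Y] [LinearOrder Y]

/-- This one statement gives both axioms: conjugation invariance with the identity for `E`, and
invariance under isomorphism with `γ = 1`. -/
theorem wreathCount_transport {cA : RepFunction.{u} A} (hcA : IsCountingFunction cA)
    {cB : RepFunction.{u} B}
    {O : Subring K} {O' : Subring K'} (hOl : IsLocalField K O) (hOl' : IsLocalField K' O')
    (e : K ≃+* K') (E : Ω ≃+* Ω') (hO : O.map (e : K →+* K') = O')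
    (hE : ∀ x : K, E (algebraMap K Ω x) = algebraMap K' Ω' (e x))
    (ρ : Rep K Ω (Wreath A B Y)) (ρ' : Rep K' Ω' (Wreath A B Y)) (γ : Wreath A B Y)
    (h : ∀ g, ρ'.1 (galConj e E hE g) = γ * ρ.1 g * γ⁻¹)
    (hB : cB K' Ω' O' (barRep ρ') = cB K Ω O (barRep ρ)) :
    wreathCount Y cA cB K' Ω' O' ρ' = wreathCount Y cA cB K Ω O ρ := by
  have hbar (g) : (barRep ρ').1 (galConj e E hE g) = γ.right * (barRep ρ).1 g * γ.right⁻¹ := by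
    change (ρ'.1 (galConj e E hE g)).right = _
    rw [h]; rfl
  unfold wreathCount
  rw [hB, ← Multiset.sum_coe, ← Multiset.sum_coe]
  congr 2
  apply map_orbitReps_transport _ _ (galConj e E hE) γ.right hbar
  · intro i j hij
    obtain ⟨g, rfl⟩ := Rep.mem_orbit_range.1 hij
    rw [symbolAt_smul]
    congr 1
    -- Independence of the orbit representative: transport along the Galois automorphism `g`, which
    -- conjugates `ρ'` by `ρ' g`.
    refine count_pointRep_transport hcA hOl' hOl' (RingEquiv.refl K') g.toRingEquiv (by ext; simp)
      (fun x => g.commutes x) ρ' ρ' (ρ'.1 g) ?_ _ _ rfl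
    intro h
    rw [← map_inv, ← map_mul, ← map_mul]
    congr 1
  · intro j
    rw [symbolAt_transport e E hO hE _ _ _ hbar,
      count_pointRep_transport hcA hOl hOl' e E hO hE ρ ρ' γ h j _ rfl]

theorem isCountingFunction_wreathCount {cA : RepFunction.{u} A} (hcA : IsCountingFunction cA)
    {cB : RepFunction.{u} B} (hcB : IsCountingFunction cB) :
    IsCountingFunction (wreathCount Y cA cB) := by
  constructor
  · intro K Ω _ _ _ _ O hO ρ γ
    refine wreathCount_transport hcA hO hO (RingEquiv.refl K) (RingEquiv.refl Ω) (by ext; simp)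
      (fun x => rfl) ρ _ γ (fun g => ?_) ?_
    · rfl
    · exact hcB.conj_eq K Ω O hO (barRep ρ) γ.right
  · intro K Ω _ _ _ _ O K' Ω' _ _ _ _ O' hO hO' e E hOO' hE ρ ρ' h
    symm
    refine wreathCount_transport hcA hO hO' e E hOO' hE ρ ρ' 1 (fun g => ?_) ?_
    · rw [one_mul, inv_one, mul_one]
      exact (h g _ fun x => (galConj_apply e E hE g x).symm).symm
    · symm
      refine hcB.iso_eq K Ω O K' Ω' O' hO hO' e E hOO' hE _ _ fun g g' hg => ?_
      exact congrArg (·.right) (h g g' hg)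

end Wreath

/-! ### Parametrization of the lifts of a representation -/

section GalRes

variable {K Ω : Type u} [Field K] [Field Ω] [Algebra K Ω] {Γ X : Type*} [Group Γ] [MulAction Γ X]

theorem galRes_injective (L : IntermediateField K Ω) : Function.Injective (galRes L) := by
  intro g h hgh
  ext x
  exact DFunLike.congr_fun hgh x

/-- An element of the stabilizer of a point, as an automorphism over the fixed field. -/
def Rep.stabLift (ρ : Rep K Ω Γ) (x : X) (g : Gal(Ω/K)) (hg : g ∈ ρ.stab x) :
    Gal(Ω/ρ.pointField x) :=
  AlgEquiv.ofRingEquiv (f := g.toRingEquiv) fun y => Rep.mem_pointField.1 y.2 g hg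

theorem Rep.galRes_stabLift (ρ : Rep K Ω Γ) (x : X) (g : Gal(Ω/K)) (hg : g ∈ ρ.stab x) :
    galRes _ (ρ.stabLift x g hg) = g := rfl

variable [IsSepClosure K Ω]

theorem Rep.range_galRes (ρ : Rep K Ω Γ) (x : X) :
    Set.range (galRes (ρ.pointField x)) = ρ.stab x := by
  ext g
  constructor
  · rintro ⟨g, rfl⟩
    exact galRes_mem_stab ρ x g
  · intro hg
    exact ⟨ρ.stabLift x g hg, rfl⟩

/-- A continuous injection of a compact group into a Hausdorff one is a closed embedding, and its
image is the open stabilizer. -/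
theorem Rep.isOpenEmbedding_galRes (ρ : Rep K Ω Γ) (x : X) :
    Topology.IsOpenEmbedding (galRes (ρ.pointField x)) := by
  have : T2Space Gal(Ω/K) := krullTopology_t2
  have h := (galRes_continuous (ρ.pointField x)).isClosedEmbedding (galRes_injective _)
  refine ⟨h.isEmbedding, ?_⟩
  rw [ρ.range_galRes]
  exact ρ.stab_isOpen x

theorem Rep.isOpen_ker {K Ω Γ : Type*} [Field K] [Field Ω] [Algebra K Ω] [Group Γ]
    (ρ : Rep K Ω Γ) : IsOpen {g : Gal(Ω/K) | ρ.1 g = 1} := by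
  let _ : TopologicalSpace Γ := ⊥
  have : DiscreteTopology Γ := ⟨rfl⟩
  exact (isOpen_discrete ({1} : Set Γ)).preimage ρ.2

theorem continuous_of_eq_one {G Γ : Type*} [Group G] [TopologicalSpace G] [IsTopologicalGroup G]
    [Group Γ] (f : G →* Γ) (U : Set G) (hU : IsOpen U) (h1 : 1 ∈ U) (h : ∀ g ∈ U, f g = 1) :
    @Continuous G Γ _ ⊥ f := by
  let _ : TopologicalSpace Γ := ⊥
  have : DiscreteTopology Γ := ⟨rfl⟩
  refine continuous_of_continuousAt_one f ?_
  refine (continuousAt_const (y := (1 : Γ))).congr ?_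
  filter_upwards [hU.mem_nhds h1] with g hg
  exact (h g hg).symm

end GalRes

section Transporter

variable {K Ω : Type u} [Field K] [Field Ω] [Algebra K Ω]
variable {B Y : Type*} [Group B] [MulAction B Y] [Fintype Y] [LinearOrder Y]

open Classical in
/-- A Galois element carrying the canonical representative of the orbit of `j` to `j`. -/
def transporter (φ : Rep K Ω B) (j : Y) : Gal(Ω/K) :=
  -- The value 1 at representatives is essential: the loop of a stabilizing element at a
  -- representative is then the element itself, so `ρ_i` is recovered exactly and not only up to
  -- conjugation.
  if j ∈ orbitReps φ then 1 else (Rep.mem_orbit_range.1 (mem_orbit_repOf φ j)).choose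

theorem transporter_of_mem (φ : Rep K Ω B) {j : Y} (hj : j ∈ orbitReps φ) :
    transporter φ j = 1 := if_pos hj

theorem transporter_smul (φ : Rep K Ω B) (j : Y) : φ.1 (transporter φ j) • repOf φ j = j := by
  rw [transporter]
  split_ifs with h
  · rw [map_one, one_smul, repOf_of_mem φ h]
  · exact (Rep.mem_orbit_range.1 (mem_orbit_repOf φ j)).choose_spec

theorem transporter_inv_smul (φ : Rep K Ω B) (j : Y) :
    (φ.1 (transporter φ j))⁻¹ • j = repOf φ j := by
  rw [inv_smul_eq_iff, transporter_smul]

/-- The loop at the canonical representative given by `g : g⁻¹ j → j`. -/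
def loop (φ : Rep K Ω B) (g : Gal(Ω/K)) (j : Y) : Gal(Ω/K) :=
  (transporter φ j)⁻¹ * g * transporter φ ((φ.1 g)⁻¹ • j)

theorem repOf_inv_smul (φ : Rep K Ω B) (g : Gal(Ω/K)) (j : Y) :
    repOf φ ((φ.1 g)⁻¹ • j) = repOf φ j := by
  rw [← map_inv, repOf_smul]

theorem loop_mem (φ : Rep K Ω B) (g : Gal(Ω/K)) (j : Y) : loop φ g j ∈ φ.stab (repOf φ j) := by
  have h := transporter_smul φ ((φ.1 g)⁻¹ • j)
  rw [repOf_inv_smul] at h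
  rw [Rep.mem_stab, loop, map_mul, map_mul, mul_smul, mul_smul, h, smul_inv_smul, map_inv,
    transporter_inv_smul]

/-- The inner transporters cancel. This cocycle identity is what makes `LiftData.toHom`
multiplicative. -/
theorem loop_mul (φ : Rep K Ω B) (g h : Gal(Ω/K)) (j : Y) :
    loop φ (g * h) j = loop φ g j * loop φ h ((φ.1 g)⁻¹ • j) := by
  simp only [loop, map_mul, mul_inv_rev, mul_smul]
  group

end Transporter

section LiftData

variable {K Ω : Type u} [Field K] [Field Ω] [Algebra K Ω]
variable {A B Y : Type*} [Group A] [Group B] [MulAction B Y] [Fintype Y] [LinearOrder Y]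

/-- The data that determine a lift of `φ`. -/
abbrev LiftData (A : Type*) [Group A] (φ : Rep K Ω B) (Y : Type*) [MulAction B Y] [Fintype Y]
    [LinearOrder Y] :=
  (∀ i : {i : Y // i ∈ orbitReps φ}, Rep (φ.pointField i.1) Ω A) ×
    ({j : Y // j ∉ orbitReps φ} → A)

open Classical in
/-- The remaining elements of `A`, extended by `1` to the canonical representatives. -/
def LiftData.edge {φ : Rep K Ω B} (d : LiftData A φ Y) (j : Y) : A :=
  if h : j ∉ orbitReps φ then d.2 ⟨j, h⟩ else 1

theorem LiftData.edge_of_mem {φ : Rep K Ω B} (d : LiftData A φ Y) {j : Y} (h : j ∈ orbitReps φ) :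
    d.edge j = 1 := dif_neg (by simpa using h)

variable [IsSepClosure K Ω]

open Classical in
/-- The family of point representations as functions on the whole Galois group. -/
def LiftData.pointFun {φ : Rep K Ω B} (d : LiftData A φ Y) (i : Y) (g : Gal(Ω/K)) : A :=
  if h : i ∈ orbitReps φ ∧ g ∈ φ.stab i then (d.1 ⟨i, h.1⟩).1 (φ.stabLift i g h.2) else 1

theorem LiftData.pointFun_galRes {φ : Rep K Ω B} (d : LiftData A φ Y)
    (i : {i : Y // i ∈ orbitReps φ}) (g : Gal(Ω/φ.pointField i.1)) :
    d.pointFun i (galRes _ g) = (d.1 i).1 g :=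
  dif_pos ⟨i.2, galRes_mem_stab φ i.1 g⟩

theorem LiftData.pointFun_mul {φ : Rep K Ω B} (d : LiftData A φ Y) (i : Y) {g h : Gal(Ω/K)}
    (hg : g ∈ φ.stab i) (hh : h ∈ φ.stab i) :
    d.pointFun i (g * h) = d.pointFun i g * d.pointFun i h := by
  by_cases hi : i ∈ orbitReps φ
  · have h1 := d.pointFun_galRes ⟨i, hi⟩ (φ.stabLift i g hg)
    have h2 := d.pointFun_galRes ⟨i, hi⟩ (φ.stabLift i h hh)
    have h3 := d.pointFun_galRes ⟨i, hi⟩ (φ.stabLift i g hg * φ.stabLift i h hh)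
    rw [map_mul, map_mul] at h3
    exact h3.trans (by rw [← h1, ← h2]; rfl)
  · simp [LiftData.pointFun, hi]

theorem LiftData.pointFun_one {φ : Rep K Ω B} (d : LiftData A φ Y) (i : Y) :
    d.pointFun i 1 = 1 := by
  have := d.pointFun_mul i (one_mem (φ.stab i)) (one_mem _)
  rw [mul_one] at this
  exact left_eq_mul.1 this

/-- The homomorphism to the wreath product with the given data. -/
def LiftData.toHom {φ : Rep K Ω B} (d : LiftData A φ Y) : Gal(Ω/K) →* Wreath A B Y :=
  -- The formula is forced by `g = t_j · loop · t_{g⁻¹j}⁻¹`, with `edge j` in the role of the `j`-th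
  -- component of the image of `t_j`.
  MonoidHom.mk' (fun g => ⟨fun j => d.edge j * d.pointFun (repOf φ j) (loop φ g j) *
    (d.edge ((φ.1 g)⁻¹ • j))⁻¹, φ.1 g⟩) (by
      intro g h
      refine SemidirectProduct.ext (funext fun j => ?_) (map_mul _ _ _)
      rw [Wreath.mul_left_apply]
      dsimp only
      rw [loop_mul, d.pointFun_mul _ (loop_mem φ g j)
        (repOf_inv_smul φ g j ▸ loop_mem φ h ((φ.1 g)⁻¹ • j)), repOf_inv_smul, map_mul, mul_inv_rev,
        mul_smul]
      group)

theorem LiftData.continuous_toHom {φ : Rep K Ω B} (d : LiftData A φ Y) :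
    @Continuous Gal(Ω/K) (Wreath A B Y) _ ⊥ d.toHom := by
  let V (j : Y) : Set Gal(Ω/K) :=
    galRes _ '' {g | (d.1 ⟨repOf φ j, repOf_mem φ j⟩).1 g = 1}
  have hV (j : Y) : IsOpen (V j) :=
    (φ.isOpenEmbedding_galRes (repOf φ j)).isOpenMap _ (Rep.isOpen_ker _)
  -- On the kernel of `φ` every `j` is fixed, so the edge factors surround `ρ_i` evaluated at the
  -- conjugate of `g` by the transporter. Requiring these finitely many conjugates to lie in the
  -- open kernels makes all components trivial.
  refine continuous_of_eq_one _ ({g | φ.1 g = 1} ∩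
    ⋂ j, (fun g => (transporter φ j)⁻¹ * g * transporter φ j) ⁻¹' V j) ?_ ?_ ?_
  · refine φ.isOpen_ker.inter (isOpen_iInter_of_finite fun j => (hV j).preimage ?_)
    fun_prop
  · refine ⟨map_one _, Set.mem_iInter.2 fun j => ⟨1, map_one _, ?_⟩⟩
    simp
  · rintro g ⟨h1, h2⟩
    have h1 : φ.1 g = 1 := h1
    refine SemidirectProduct.ext (funext fun j => ?_) h1
    obtain ⟨s, hs, hs'⟩ := Set.mem_iInter.1 h2 j
    dsimp only at hs'
    change d.edge j * d.pointFun (repOf φ j) (loop φ g j) * (d.edge ((φ.1 g)⁻¹ • j))⁻¹ = 1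
    rw [loop, h1, inv_one, one_smul, ← hs', d.pointFun_galRes ⟨repOf φ j, repOf_mem φ j⟩]
    have hs : (d.1 ⟨repOf φ j, repOf_mem φ j⟩).1 s = 1 := hs
    rw [hs]
    simp

end LiftData

section Lifts

variable {K Ω : Type u} [Field K] [Field Ω] [Algebra K Ω]
variable {A B Y : Type*} [Group A] [Group B] [MulAction B Y]

/-- The lifts of `φ` to the wreath product. -/
abbrev Lifts (A : Type*) [Group A] (φ : Rep K Ω B) (Y : Type*) [MulAction B Y] :=
  {ρ : Rep K Ω (Wreath A B Y) // barRep ρ = φ}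

theorem Lifts.right_apply {φ : Rep K Ω B} (ρ : Lifts A φ Y) (g : Gal(Ω/K)) :
    (ρ.1.1 g).right = φ.1 g := by
  obtain ⟨ρ, rfl⟩ := ρ
  rfl

variable [IsSepClosure K Ω]

/-- The representation `ρ_j` for a lift `ρ` of `φ`. -/
def Lifts.point {φ : Rep K Ω B} (ρ : Lifts A φ Y) (j : Y) : Rep (φ.pointField j) Ω A :=
  ρ.2 ▸ pointRep ρ.1 j

theorem Lifts.point_apply {φ : Rep K Ω B} (ρ : Lifts A φ Y) (j : Y) (g : Gal(Ω/φ.pointField j)) :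
    (ρ.point j).1 g = (ρ.1.1 (galRes _ g)).left j := by
  obtain ⟨ρ, rfl⟩ := ρ
  rfl

variable [Fintype Y] [LinearOrder Y]

/-- Lifts of `φ` to the wreath product correspond to families of representations of the stabilizers
of the canonical representatives, together with one element of `A` for each other point. -/
def liftsEquiv (A : Type*) [Group A] (φ : Rep K Ω B) : Lifts A φ Y ≃ LiftData A φ Y where
  toFun ρ := (fun i => ρ.point i.1, fun j => (ρ.1.1 (transporter φ j.1)).left j.1)
  invFun d := ⟨⟨d.toHom, d.continuous_toHom⟩, Subtype.ext (MonoidHom.ext fun _ => rfl)⟩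
  left_inv ρ := by
    set d : LiftData A φ Y :=
      (fun i => ρ.point i.1, fun j => (ρ.1.1 (transporter φ j.1)).left j.1) with hd
    have hedge (j : Y) : d.edge j = (ρ.1.1 (transporter φ j)).left j := by
      by_cases hj : j ∈ orbitReps φ
      · rw [d.edge_of_mem hj, transporter_of_mem φ hj, map_one]; rfl
      · exact dif_pos hj
    have hpt (j : Y) (g) (hg : g ∈ φ.stab (repOf φ j)) :
        d.pointFun (repOf φ j) g = (ρ.1.1 g).left (repOf φ j) := by
      have := d.pointFun_galRes ⟨repOf φ j, repOf_mem φ j⟩ (φ.stabLift _ g hg)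
      rw [Rep.galRes_stabLift] at this
      rw [this]
      exact Lifts.point_apply ρ _ _
    apply Subtype.ext
    apply Subtype.ext
    ext1 g
    refine SemidirectProduct.ext (funext fun j => ?_) (ρ.right_apply g).symm
    change d.edge j * d.pointFun (repOf φ j) (loop φ g j) * (d.edge ((φ.1 g)⁻¹ • j))⁻¹ = _
    rw [hpt _ _ (loop_mem φ g j), hedge, hedge, mul_inv_eq_iff_eq_mul]
    -- Comparing the `j`-th components of the images of both sides under `ρ` recovers the defining
    -- formula of `LiftData.toHom`.
    have h1 : transporter φ j * loop φ g j = g * transporter φ ((φ.1 g)⁻¹ • j) := by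
      rw [loop]; group
    have h2 := congrArg (fun x => (ρ.1.1 x).left j) h1
    simp only [map_mul, Wreath.mul_left_apply, ρ.right_apply, transporter_inv_smul] at h2
    exact h2
  right_inv d := by
    refine Prod.ext (funext fun i => Subtype.ext (MonoidHom.ext fun g => ?_)) (funext fun j => ?_)
    · refine (Lifts.point_apply _ _ _).trans ?_
      have h1 : (φ.1 (galRes _ g))⁻¹ • i.1 = i.1 :=
        inv_smul_eq_iff.2 (galRes_mem_stab φ i.1 g).symm
      change d.edge i.1 * d.pointFun (repOf φ i.1) (loop φ (galRes _ g) i.1) *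
        (d.edge ((φ.1 (galRes _ g))⁻¹ • i.1))⁻¹ = _
      rw [loop, h1, d.edge_of_mem i.2, transporter_of_mem φ i.2, repOf_of_mem φ i.2]
      simp [d.pointFun_galRes]
    · change d.edge j.1 * d.pointFun (repOf φ j.1) (loop φ (transporter φ j.1) j.1) *
        (d.edge ((φ.1 (transporter φ j.1))⁻¹ • j.1))⁻¹ = _
      rw [loop, transporter_inv_smul, d.edge_of_mem (repOf_mem φ j.1),
        transporter_of_mem φ (repOf_mem φ j.1), inv_mul_cancel, one_mul, d.pointFun_one]
      simp [LiftData.edge, j.2]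

end Lifts

/-! ### Sums and products of nonnegative families -/

section Sums

theorem hasSum_congr {α : Type*} {f g : α → ℝ} {a b : ℝ} (h : HasSum f a) (hf : ∀ x, g x = f x)
    (hab : b = a) : HasSum g b := by
  rw [show g = f from funext hf, hab]
  exact h

/-- Nonnegativity turns iterated convergence into convergence. This matters since the sums can be
infinite when `K` has positive characteristic. -/
theorem hasSum_sigma_of_nonneg {α : Type*} {β : α → Type*} {f : (Σ x, β x) → ℝ} {g : α → ℝ} {a : ℝ}
    (hf : ∀ x, 0 ≤ f x) (h : ∀ x, HasSum (fun y => f ⟨x, y⟩) (g x)) (hg : HasSum g a) :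
    HasSum f a := by
  have hs : Summable f := (summable_sigma_of_nonneg hf).2
    ⟨fun x => (h x).summable, by simpa only [(h _).tsum_eq] using hg.summable⟩
  have := hs.hasSum
  rwa [(this.sigma h).unique hg] at this

theorem hasSum_mul_of_nonneg {α β : Type*} {f : α → ℝ} {g : β → ℝ} {a b : ℝ} (hf : HasSum f a)
    (hg : HasSum g b) (hf' : ∀ x, 0 ≤ f x) (hg' : ∀ x, 0 ≤ g x) :
    HasSum (fun x : α × β => f x.1 * g x.2) (a * b) :=
  hf.mul hg (hf.summable.mul_of_nonneg hg.summable hf' hg')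

theorem hasSum_pi_equiv {α β : Type*} [Fintype α] [Fintype β] (e : α ≃ β) {R : β → Type*}
    {f : ∀ i, R i → ℝ} {a : β → ℝ}
    (h : HasSum (fun x : ∀ i, R (e i) => ∏ i, f (e i) (x i)) (∏ i, a (e i))) :
    HasSum (fun x : ∀ i, R i => ∏ i, f i (x i)) (∏ i, a i) := by
  rw [← (Equiv.piCongrLeft R e).hasSum_iff]
  refine hasSum_congr h (fun x => ?_) (Equiv.prod_comp e a).symm
  rw [Function.comp_apply, ← Equiv.prod_comp e]
  simp [Equiv.piCongrLeft_apply_apply]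

theorem hasSum_pi_option {α : Type*} [Fintype α] {R : Option α → Type*} {f : ∀ i, R i → ℝ}
    {a : Option α → ℝ} (h0 : ∀ i x, 0 ≤ f i x) (h : ∀ i, HasSum (f i) (a i))
    (hα : HasSum (fun x : ∀ i, R (some i) => ∏ i, f (some i) (x i)) (∏ i, a (some i))) :
    HasSum (fun x : ∀ i, R i => ∏ i, f i (x i)) (∏ i, a i) := by
  have := hasSum_mul_of_nonneg (h none) hα (h0 none)
    (fun x => Finset.prod_nonneg fun i _ => h0 _ _)
  rw [← (Equiv.piOptionEquivProd).hasSum_iff] at this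
  refine hasSum_congr this (fun x => ?_) ?_
  · rw [Fintype.prod_option]; rfl
  · rw [Fintype.prod_option]

universe v w

/-- Products over `ι` of sums of nonnegative terms can be expanded. -/
def ProdHasSum (ι : Type v) [Fintype ι] : Prop :=
  ∀ (R : ι → Type w) (f : ∀ i, R i → ℝ) (a : ι → ℝ), (∀ i x, 0 ≤ f i x) →
    (∀ i, HasSum (f i) (a i)) → HasSum (fun x : ∀ i, R i => ∏ i, f i (x i)) (∏ i, a i)

theorem ProdHasSum.of_equiv {α β : Type v} [Fintype β] (e : α ≃ β)
    (h : @ProdHasSum.{v, w} α (Fintype.ofEquiv β e.symm)) : ProdHasSum.{v, w} β := by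
  intro R f a h0 h1
  let _ := Fintype.ofEquiv β e.symm
  have := h (fun i => R (e i)) (fun i => f (e i)) (fun i => a (e i)) (fun i => h0 (e i))
    (fun i => h1 (e i))
  exact hasSum_pi_equiv (R := R) (f := f) (a := a) e this

theorem prodHasSum_pempty : ProdHasSum.{v, w} PEmpty := by
  intro R f a _ _
  have h := hasSum_unique (fun x : ∀ i : PEmpty, R i => ∏ i, f i (x i))
  rw [Fintype.prod_empty] at h ⊢
  exact h

theorem ProdHasSum.option {α : Type v} [Fintype α] (h : ProdHasSum.{v, w} α) :
    ProdHasSum.{v, w} (Option α) := by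
  intro R f a h0 h1
  exact hasSum_pi_option h0 h1 (h (fun i => R (some i)) (fun i => f (some i))
    (fun i => a (some i)) (fun i => h0 (some i)) (fun i => h1 (some i)))

/-- A finite product of sums of nonnegative terms is a sum over the product of the index sets. -/
theorem prodHasSum (ι : Type v) [Fintype ι] : ProdHasSum.{v, w} ι := by
  refine Fintype.induction_empty_option (P := fun ι _ => ProdHasSum.{v, w} ι) ?_ ?_ ?_ ι
  · intro α β _ e ih
    exact ih.of_equiv e
  · exact prodHasSum_pempty
  · intro α _ ih
    exact ih.option

end Sums

/-! ### Matching labelled lists of terms -/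

section SameTerms

variable {α β ι : Type*} [DecidableEq α]

/-- Two lists of labelled terms have the same terms with each label, in the same order. -/
def SameTerms (P T : List (α × β)) : Prop :=
  ∀ s : α, P.filter (fun t => t.1 = s) = T.filter (fun t => t.1 = s)

theorem SameTerms.perm {P T : List (α × β)} (h : SameTerms P T) : P.Perm T := by
  classical
  rw [List.perm_iff_count]
  intro x
  have := congrArg (List.count x) (h x.1)
  rwa [List.count_filter (by simp), List.count_filter (by simp)] at this

/-- Each index in turn takes the first unused term of `T` with its label; this turns an unordered
match of labels into an assignment of a type to each orbit representative. -/
theorem exists_sameTerms [Nonempty β] (s : ι → α) : ∀ (l : List ι) (T : List (α × β)), l.Nodup →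
    (l.map s).Perm (T.map Prod.fst) → ∃ τ : ι → β, SameTerms (l.map fun i => (s i, τ i)) T := by
  classical
  intro l
  induction l with
  | nil =>
    intro T _ h
    have : T = [] := by simpa using h.symm.eq_nil
    subst this
    exact ⟨fun _ => Classical.arbitrary β, fun _ => rfl⟩
  | cons i l ih =>
    intro T hl h
    have hi : s i ∈ T.map Prod.fst := h.subset (by simp)
    -- The split is at the first occurrence of the label, so removing this term keeps the order of
    -- the remaining terms with that label.
    obtain ⟨as, bs, hab, has⟩ := List.eq_append_cons_of_mem hi
    obtain ⟨T₁, T₂', rfl, rfl, h2⟩ := List.map_eq_append_iff.1 hab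
    obtain ⟨⟨c, b⟩, T₂, rfl, hc, rfl⟩ := List.map_eq_cons_iff.1 h2
    dsimp only at hc
    subst hc
    have hperm : (l.map s).Perm ((T₁ ++ T₂).map Prod.fst) := by
      have h3 : (s i :: l.map s).Perm (s i :: (T₁ ++ T₂).map Prod.fst) := by
        refine h.trans ?_
        simp only [List.map_append, List.map_cons]
        exact List.perm_middle
      exact h3.cons_inv
    obtain ⟨τ, hτ⟩ := ih (T₁ ++ T₂) (List.nodup_cons.1 hl).2 hperm
    refine ⟨Function.update τ i b, fun c => ?_⟩
    have h4 : (l.map fun k => (s k, Function.update τ i b k)) = l.map fun k => (s k, τ k) := by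
      apply List.map_congr_left
      intro k hk
      rw [Function.update_of_ne]
      rintro rfl
      exact (List.nodup_cons.1 hl).1 hk
    have h5 := hτ c
    rw [List.map_cons, h4, List.filter_cons, h5, List.filter_append, List.filter_append,
      List.filter_cons, Function.update_self]
    by_cases hc : s i = c
    · have : T₁.filter (fun t => t.1 = c) = [] := by
        rw [List.filter_eq_nil_iff]
        intro t ht h
        apply has
        rw [hc, ← of_decide_eq_true h]
        exact List.mem_map_of_mem ht
      simp [hc, this]
    · simp [hc]

/-- Both lists have the same label at each index, so filtering by a label keeps the same indices on
both sides and the terms can be compared one by one. -/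
theorem sameTerms_map_iff (s : ι → α) (l : List ι) (τ τ' : ι → β) :
    SameTerms (l.map fun i => (s i, τ i)) (l.map fun i => (s i, τ' i)) ↔
      ∀ i ∈ l, τ i = τ' i := by
  constructor
  · intro h i hi
    have := h (s i)
    rw [List.filter_map, List.filter_map] at this
    have := List.map_inj_left.1 this i (by simp [hi])
    exact (Prod.ext_iff.1 this).2
  · intro h
    have : (l.map fun i => (s i, τ i)) = l.map fun i => (s i, τ' i) :=
      List.map_congr_left fun i hi => by rw [h i hi]
    rw [this]
    exact fun _ => rfl

theorem SameTerms.symm {P T : List (α × β)} (h : SameTerms P T) : SameTerms T P :=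
  fun s => (h s).symm

theorem SameTerms.trans {P T S : List (α × β)} (h : SameTerms P T) (h' : SameTerms T S) :
    SameTerms P S :=
  fun s => (h s).trans (h' s)

end SameTerms

/-! ### The mass of a wreath type -/

section WreathMass

variable {K Ω : Type u} [Field K] [Field Ω] [Algebra K Ω]
variable {A B X Y : Type*} [Group B] [MulAction B Y] [Fintype Y] [LinearOrder Y]

theorem sum_orbitReps {M : Type*} [AddCommMonoid M] (φ : Rep K Ω B)
    [Fintype {i : Y // i ∈ orbitReps φ}] (g : Y → M) :
    ((orbitReps φ).map g).sum = ∑ i : {i : Y // i ∈ orbitReps φ}, g i := by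
  rw [← List.sum_toFinset _ (nodup_orbitReps φ)]
  exact Finset.sum_subtype _ (by simp) g

theorem prod_orbitReps {M : Type*} [CommMonoid M] (φ : Rep K Ω B) (g : Y → M) :
    ((orbitReps φ).map g).prod = ∏ i : {i : Y // i ∈ orbitReps φ}, g i := by
  rw [← List.prod_toFinset _ (nodup_orbitReps φ)]
  exact Finset.prod_subtype _ (by simp) g

theorem card_not_mem_orbitReps (φ : Rep K Ω B) :
    Nat.card {j : Y // j ∉ orbitReps φ} = Fintype.card Y - (orbitReps φ : List Y).length := by
  classical
  rw [Nat.card_eq_fintype_card, Fintype.card_subtype_compl]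
  congr 1
  rw [Fintype.card_subtype, ← List.toFinset_card_of_nodup (nodup_orbitReps φ)]
  congr 1
  ext; simp

theorem hasSum_one_complement [Finite A] (φ : Rep K Ω B) :
    HasSum (fun _ : {j : Y // j ∉ orbitReps φ} → A => (1 : ℝ))
      ((Nat.card A : ℝ) ^ (Fintype.card Y - (orbitReps φ : List Y).length)) := by
  classical
  have := Fintype.ofFinite A
  refine hasSum_congr (hasSum_fintype fun _ : {j : Y // j ∉ orbitReps φ} → A => (1 : ℝ))
    (fun _ => rfl) ?_
  rw [← card_not_mem_orbitReps φ, Finset.sum_const, Finset.card_univ, Fintype.card_fun,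
    Nat.card_eq_fintype_card, Nat.card_eq_fintype_card]
  simp

variable [IsSepClosure K Ω] [Group A] [MulAction A X] [Fintype X]

theorem Lifts.wreathTerms_eq (O : Subring K) {φ : Rep K Ω B} (ρ : Lifts A φ Y) :
    wreathTerms X O ρ.1 = (orbitReps φ).map fun i =>
      (symbolAt O φ i, repType X (integersIn O (φ.pointField i)) (ρ.point i)) := by
  obtain ⟨ρ, rfl⟩ := ρ
  rfl

theorem Lifts.wreathCount_eq (cA : RepFunction.{u} A) (cB : RepFunction.{u} B) (O : Subring K)
    {φ : Rep K Ω B} (ρ : Lifts A φ Y) :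
    wreathCount Y cA cB K Ω O ρ.1 = cB K Ω O φ + ∑ i : {i : Y // i ∈ orbitReps φ},
      (symbolAt O φ i.1).1 * cA (φ.pointField i.1) Ω (integersIn O _) (ρ.point i.1) := by
  rw [← sum_orbitReps φ fun i => (symbolAt O φ i).1 * cA (φ.pointField i) Ω (integersIn O _) (ρ.point i)]
  obtain ⟨ρ, rfl⟩ := ρ
  rfl

/-- Once one assignment `τ` realizes `T`, the wreath type becomes a separate condition at each orbit
representative. This decoupling lets the sum over lifts factor. -/
theorem Lifts.hasWreathType_iff {O : Subring K} {φ : Rep K Ω B}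
    {T : List ((ℕ × ℕ) × Multiset (ℕ × ℕ))} {τ : Y → Multiset (ℕ × ℕ)}
    (hτ : SameTerms ((orbitReps φ).map fun i => (symbolAt O φ i, τ i)) T) (ρ : Lifts A φ Y) :
    HasWreathType X O ρ.1 T ↔ ∀ i : {i : Y // i ∈ orbitReps φ},
      repType X (integersIn O (φ.pointField i.1)) ((liftsEquiv A φ ρ).1 i) = τ i.1 := by
  have h1 : HasWreathType X O ρ.1 T ↔ SameTerms (wreathTerms X O ρ.1) T := Iff.rfl
  rw [h1, ρ.wreathTerms_eq]
  have h2 := sameTerms_map_iff (symbolAt O φ) (orbitReps φ)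
    (fun i => repType X (integersIn O (φ.pointField i)) (ρ.point i)) τ
  refine Iff.trans ⟨fun h => h.trans hτ.symm, fun h => h.trans hτ⟩ (h2.trans ?_)
  exact ⟨fun h i => h i.1 i.2, fun h i hi => h ⟨i, hi⟩⟩

/-- The representations into `A` of the fixed field of the stabilizer of `i`, of type `σ`. -/
abbrev PointReps (A X : Type*) [Group A] [MulAction A X] [Fintype X] (O : Subring K)
    (φ : Rep K Ω B) (i : Y) (σ : Multiset (ℕ × ℕ)) :=
  {ψ : Rep (φ.pointField i) Ω A // repType X (integersIn O (φ.pointField i)) ψ = σ}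

/-- The lifts of `φ` of a given wreath type correspond to families of representations of given
types, together with one element of `A` for each point that is not a canonical representative. -/
def wreathLiftsEquiv (A X : Type*) [Group A] [MulAction A X] [Fintype X] {O : Subring K}
    {φ : Rep K Ω B} {T : List ((ℕ × ℕ) × Multiset (ℕ × ℕ))} {τ : Y → Multiset (ℕ × ℕ)}
    (hτ : SameTerms ((orbitReps φ).map fun i => (symbolAt O φ i, τ i)) T) :
    {ρ : Lifts A φ Y // HasWreathType X O ρ.1 T} ≃
      (∀ i : {i : Y // i ∈ orbitReps φ}, PointReps A X O φ i.1 (τ i.1)) ×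
        ({j : Y // j ∉ orbitReps φ} → A) where
  toFun ρ := (fun i => ⟨(liftsEquiv A φ ρ.1).1 i, (Lifts.hasWreathType_iff hτ ρ.1).1 ρ.2 i⟩,
    (liftsEquiv A φ ρ.1).2)
  invFun d := ⟨(liftsEquiv A φ).symm (fun i => (d.1 i).1, d.2),
    (Lifts.hasWreathType_iff hτ _).2 fun i => by
      rw [Equiv.apply_symm_apply]
      exact (d.1 i).2⟩
  left_inv ρ := Subtype.ext ((liftsEquiv A φ).symm_apply_apply ρ.1)
  right_inv d := by
    have h := (liftsEquiv A φ).apply_symm_apply (fun i => (d.1 i).1, d.2)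
    refine Prod.ext (funext fun i => Subtype.ext ?_) ?_
    · exact congrFun (Prod.ext_iff.1 h).1 i
    · exact (Prod.ext_iff.1 h).2

theorem prod_terms_eq {O : Subring K} (hO : IsLocalField K O) {φ : Rep K Ω B}
    {T : List ((ℕ × ℕ) × Multiset (ℕ × ℕ))} {τ : Y → Multiset (ℕ × ℕ)}
    (hτ : SameTerms ((orbitReps φ).map fun i => (symbolAt O φ i, τ i)) T)
    (fA : Multiset (ℕ × ℕ) → Polynomial ℤ) :
    (T.map fun t => Polynomial.aeval (((residueCard O : ℝ) ^ t.1.1)⁻¹) (fA t.2)).prod =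
      ∏ i : {i : Y // i ∈ orbitReps φ}, Polynomial.aeval
        ((residueCard (integersIn O (φ.pointField i.1)) : ℝ)⁻¹) (fA (τ i.1)) := by
  rw [← (hτ.perm.map _).prod_eq, List.map_map, ← prod_orbitReps φ fun i => Polynomial.aeval
      ((residueCard (integersIn O (φ.pointField i)) : ℝ)⁻¹) (fA (τ i))]
  congr 1
  refine List.map_congr_left fun i _ => ?_
  simp [residueCard_pointField hO]

/-- The total mass of the families of point representations of given types. -/
theorem hasSum_pointReps (S : FieldClass.{u}) (cA : RepFunction.{u} A)
    (fA : Multiset (ℕ × ℕ) → Polynomial ℤ)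
    (hA : ∀ σ, IsMassFormula X S cA σ (fA σ)) {O : Subring K} (hO : IsLocalField K O)
    (φ : Rep K Ω B) (hS : ∀ j : Y, S (φ.pointField j) (integersIn O (φ.pointField j)))
    (τ : Y → Multiset (ℕ × ℕ)) :
    HasSum (fun ψ : ∀ i : {i : Y // i ∈ orbitReps φ}, PointReps A X O φ i.1 (τ i.1) =>
        ∏ i : {i : Y // i ∈ orbitReps φ}, ((residueCard (integersIn O (φ.pointField i.1)) : ℝ) ^
          cA (φ.pointField i.1) Ω (integersIn O (φ.pointField i.1)) (ψ i).1)⁻¹)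
      (∏ i : {i : Y // i ∈ orbitReps φ}, Polynomial.aeval
        ((residueCard (integersIn O (φ.pointField i.1)) : ℝ)⁻¹) (fA (τ i.1))) :=
  prodHasSum {i : Y // i ∈ orbitReps φ} (fun i => PointReps A X O φ i.1 (τ i.1))
    (fun i ψ => ((residueCard (integersIn O (φ.pointField i.1)) : ℝ) ^
      cA (φ.pointField i.1) Ω (integersIn O (φ.pointField i.1)) ψ.1)⁻¹)
    (fun i => Polynomial.aeval
        ((residueCard (integersIn O (φ.pointField i.1)) : ℝ)⁻¹) (fA (τ i.1)))
    (fun i x => by positivity)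
    fun i => hA (τ i.1) (φ.pointField i.1) Ω (integersIn O (φ.pointField i.1))
      (hO.extension _) (hS i.1)

/-- The reason for the coefficients `f_i` in the counting function: they replace `q_K` by the
residue cardinality of the fixed field at `i`. -/
theorem inv_pow_wreathCount (cA : RepFunction.{u} A) (cB : RepFunction.{u} B) {O : Subring K}
    (hO : IsLocalField K O) {φ : Rep K Ω B} (ρ : Lifts A φ Y) :
    ((residueCard O : ℝ) ^ wreathCount Y cA cB K Ω O ρ.1)⁻¹ =
      ((residueCard O : ℝ) ^ cB K Ω O φ)⁻¹ * ∏ i : {i : Y // i ∈ orbitReps φ},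
        ((residueCard (integersIn O (φ.pointField i.1)) : ℝ) ^
          cA (φ.pointField i.1) Ω (integersIn O (φ.pointField i.1)) (ρ.point i.1))⁻¹ := by
  rw [Lifts.wreathCount_eq, pow_add, mul_inv, Finset.prod_inv_distrib,
    ← Finset.prod_pow_eq_pow_sum]
  congr 2
  refine Finset.prod_congr rfl fun i _ => ?_
  rw [residueCard_pointField hO, pow_mul, Nat.cast_pow]

/-- The total mass of the lifts of `φ` of a given wreath type. -/
theorem hasSum_lifts [Finite A] (S : FieldClass.{u}) (cA : RepFunction.{u} A)
    (cB : RepFunction.{u} B) (fA : Multiset (ℕ × ℕ) → Polynomial ℤ)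
    (hA : ∀ σ, IsMassFormula X S cA σ (fA σ)) {O : Subring K} (hO : IsLocalField K O)
    (φ : Rep K Ω B) (hS : ∀ j : Y, S (φ.pointField j) (integersIn O (φ.pointField j)))
    (T : List ((ℕ × ℕ) × Multiset (ℕ × ℕ)))
    (hT : repType Y O φ = Multiset.ofList (T.map Prod.fst)) :
    HasSum (fun ρ : {ρ : Lifts A φ Y // HasWreathType X O ρ.1 T} =>
        ((residueCard O : ℝ) ^ wreathCount Y cA cB K Ω O ρ.1.1)⁻¹)
      (((residueCard O : ℝ) ^ cB K Ω O φ)⁻¹ * ((Nat.card A : ℝ) ^ (Fintype.card Y - T.length) *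
        (T.map fun t =>
          Polynomial.aeval (((residueCard O : ℝ) ^ t.1.1)⁻¹) (fA t.2)).prod)) := by
  rw [repType_eq_map_orbitReps, Multiset.coe_eq_coe] at hT
  have hlen : (orbitReps φ : List Y).length = T.length := by simpa using hT.length_eq
  obtain ⟨τ, hτ⟩ := exists_sameTerms (symbolAt O φ) (orbitReps φ : List Y) T (nodup_orbitReps φ) hT
  have h := (hasSum_mul_of_nonneg (hasSum_pointReps S cA fA hA hO φ hS τ)
    (hasSum_one_complement (A := A) (Y := Y) φ) (fun _ => Finset.prod_nonneg fun i _ => by positivity)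
    fun _ => zero_le_one).mul_left ((residueCard O : ℝ) ^ cB K Ω O φ)⁻¹
  rw [← (wreathLiftsEquiv A X hτ).hasSum_iff] at h
  refine hasSum_congr h (fun ρ => ?_) ?_
  · rw [Function.comp_apply, inv_pow_wreathCount cA cB hO, mul_one]
    rfl
  · rw [prod_terms_eq hO hτ, hlen, mul_comm (_ ^ _)]

theorem HasWreathType.repType_barRep {O : Subring K} {ρ : Rep K Ω (Wreath A B Y)}
    {T : List ((ℕ × ℕ) × Multiset (ℕ × ℕ))} (h : HasWreathType X O ρ T) :
    repType Y O (barRep ρ) = Multiset.ofList (T.map Prod.fst) := by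
  have h : SameTerms (wreathTerms X O ρ) T := h
  rw [repType_eq_map_orbitReps, Multiset.coe_eq_coe]
  have := h.perm.map Prod.fst
  rw [wreathTerms, List.map_map] at this
  exact this

/-- The total mass of a wreath type. -/
theorem hasSum_wreathType [Finite A] (S : FieldClass.{u}) (cA : RepFunction.{u} A)
    (cB : RepFunction.{u} B) (hSc : ContainsPointFields S B Y)
    (fA fB : Multiset (ℕ × ℕ) → Polynomial ℤ)
    (hA : ∀ σ, IsMassFormula X S cA σ (fA σ)) (hB : ∀ σ, IsMassFormula Y S cB σ (fB σ))
    {O : Subring K} (hO : IsLocalField K O) (hS : S K O)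
    (T : List ((ℕ × ℕ) × Multiset (ℕ × ℕ))) :
    HasSum (fun ρ : {ρ : Rep K Ω (Wreath A B Y) // HasWreathType X O ρ T} =>
        ((residueCard O : ℝ) ^ wreathCount Y cA cB K Ω O ρ.1)⁻¹)
      ((Nat.card A : ℝ) ^ (Fintype.card Y - T.length) *
        Polynomial.aeval ((residueCard O : ℝ)⁻¹) (fB (Multiset.ofList (T.map Prod.fst))) *
        (T.map fun t =>
          Polynomial.aeval (((residueCard O : ℝ) ^ t.1.1)⁻¹) (fA t.2)).prod) := by
  let e : {ρ : Rep K Ω (Wreath A B Y) // HasWreathType X O ρ T} ≃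
      Σ φ : {φ : Rep K Ω B // repType Y O φ = Multiset.ofList (T.map Prod.fst)},
        {ρ : Lifts A φ.1 Y // HasWreathType X O ρ.1 T} :=
    { toFun := fun ρ => ⟨⟨barRep ρ.1, ρ.2.repType_barRep⟩, ⟨⟨ρ.1, rfl⟩, ρ.2⟩⟩
      invFun := fun x => ⟨x.2.1.1, x.2.2⟩
      left_inv := fun _ => rfl
      right_inv := by
        rintro ⟨⟨φ, h⟩, ⟨⟨ρ, hρ⟩, h'⟩⟩
        have hρ' : barRep ρ = φ := hρ
        subst hρ'
        rfl }
  rw [← e.symm.hasSum_iff]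
  -- The mass above `φ` depends on `φ` only through `cB`. If `T` is longer than the number of points
  -- of `Y`, there is no such `φ`, so the value of the polynomial for `B` is 0 and the truncated
  -- exponent of `Nat.card A` is harmless.
  refine hasSum_sigma_of_nonneg (fun x => by simp only [Function.comp_apply]; positivity)
    (fun φ => hasSum_lifts S cA cB fA hA hO φ.1 (hSc K Ω O hO hS φ.1) T φ.2) ?_
  exact hasSum_congr ((hB _ K Ω O hO hS).mul_right _) (fun _ => rfl) (by ring)

end WreathMass

/-! ### Types of representations into a wreath product -/

section TypeSection

variable {K Ω : Type u} [Field K] [Field Ω] [Algebra K Ω] {Γ X : Type*} [Group Γ] [MulAction Γ X]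

/-- The type of a representation, computed with any system of representatives of its orbits. -/
theorem repType_eq_sum {ι : Type*} [Fintype ι] [Fintype X] (O : Subring K) (ρ : Rep K Ω Γ)
    (F : ι → X) (hF : ∀ x, ∃ i, ∃ g, ρ.1 g • F i = x)
    (hF' : ∀ i j g, ρ.1 g • F i = F j → i = j) :
    repType X O ρ = ∑ i, {symbolAt O ρ (F i)} := by
  classical
  let e : ι ≃ MulAction.orbitRel.Quotient ρ.1.range X :=
    Equiv.ofBijective (fun i => Quotient.mk (MulAction.orbitRel ρ.1.range X) (F i)) (by
      constructor
      · intro i j hij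
        obtain ⟨g, hg⟩ := Rep.mem_orbit_range.1
          (MulAction.mem_orbit_symm.1 (Quotient.exact hij))
        exact hF' i j g hg
      · intro o
        induction o using Quotient.inductionOn with
        | h x =>
          obtain ⟨i, g, hg⟩ := hF x
          refine ⟨i, Quotient.sound ?_⟩
          exact MulAction.mem_orbit_symm.1 (Rep.mem_orbit_range.2 ⟨g, hg⟩))
  have h1 : repType X O ρ = ∑ o : MulAction.orbitRel.Quotient ρ.1.range X,
      {symbolAt O ρ o.out} := by
    rw [repType, ← Multiset.sum_map_singleton (Multiset.map _ _), Multiset.map_map]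
    rfl
  rw [h1, ← e.sum_comp]
  refine Finset.sum_congr rfl fun i _ => ?_
  congr 1
  exact symbolAt_eq_of_mem_orbit O ρ
    (Quotient.mk_out (s := MulAction.orbitRel ρ.1.range X) (F i))

/-- Representatives of the orbits. -/
theorem exists_repType_eq_sum.{w} {X : Type w} [MulAction Γ X] [Fintype X] (ρ : Rep K Ω Γ) :
    ∃ (ι : Type w) (_ : Fintype ι) (F : ι → X), (∀ x, ∃ i, ∃ g, ρ.1 g • F i = x) ∧
      (∀ i j g, ρ.1 g • F i = F j → i = j) ∧ Fintype.card ι ≤ Fintype.card X := by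
  classical
  refine ⟨MulAction.orbitRel.Quotient ρ.1.range X, inferInstance, fun o => o.out, ?_, ?_,
    Fintype.card_le_of_surjective _ Quotient.mk_surjective⟩
  · intro x
    refine ⟨Quotient.mk _ x, ?_⟩
    exact Rep.mem_orbit_range.1 (MulAction.mem_orbit_symm.1
      (Quotient.mk_out (s := MulAction.orbitRel ρ.1.range X) x))
  · intro i j g h
    rw [← Quotient.out_eq i, ← Quotient.out_eq j]
    exact Quotient.sound (MulAction.mem_orbit_symm.1 (Rep.mem_orbit_range.2 ⟨g, h⟩))

theorem index_stab_le [Fintype X] (ρ : Rep K Ω Γ) (x : X) :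
    (ρ.stab x).index ≤ Fintype.card X := by
  rw [← ncard_orbit_eq_index_stab, ← Nat.card_eq_fintype_card]
  exact Set.ncard_le_card _

theorem symbolAt_le [Fintype X] (O : Subring K) (ρ : Rep K Ω Γ) (x : X) :
    (symbolAt O ρ x).1 ≤ Fintype.card X ∧ (symbolAt O ρ x).2 ≤ Fintype.card X := by
  have h := index_stab_le ρ x
  rw [← symbolAt_mul O] at h
  exact ⟨(Nat.le_mul_of_pos_right _ (symbolAt_snd_pos O ρ x)).trans h,
    (Nat.le_mul_of_pos_left _ (symbolAt_fst_pos O ρ x)).trans h⟩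

end TypeSection

section WreathTypes

theorem wreath_smul {A B X Y : Type*} [Group A] [Group B] [MulAction A X] [MulAction B Y]
    (w : Wreath A B Y) (i : Y) (x : X) :
    w • (i, x) = (w.right • i, w.left (w.right • i) • x) := rfl

variable {K Ω : Type u} [Field K] [Field Ω] [Algebra K Ω]
variable {A B X Y : Type*} [Group A] [Group B] [MulAction A X] [MulAction B Y]

theorem inertia_comap_galRes {O : Subring K} (L : IntermediateField K Ω) :
    inertia (integersIn O L) Ω = (inertia O Ω).comap (galRes L) := by
  -- The two rings of integers of `Ω` are equal but not by definition, so the inertia condition is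
  -- carried along an arbitrary equality of subrings.
  have key : ∀ (R R' : Subring Ω), R = R' → ∀ g : Gal(Ω/K),
      (∀ x ∈ R, ∃ m ∈ Ideal.jacobson (⊥ : Ideal R), (m : Ω) = g x - x) ↔
        ∀ x ∈ R', ∃ m ∈ Ideal.jacobson (⊥ : Ideal R'), (m : Ω) = g x - x := by
    rintro R _ rfl g
    exact Iff.rfl
  ext g
  exact key _ _ (integersIn_integersIn O L) (galRes L g)

variable [IsSepClosure K Ω]

theorem pointRep_smul (ρ : Rep K Ω (Wreath A B Y)) (i : Y) (x : X)
    (g : Gal(Ω/(barRep ρ).pointField i)) :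
    ρ.1 (galRes _ g) • (i, x) = (i, (pointRep ρ i).1 g • x) := by
  have h : (ρ.1 (galRes _ g)).right • i = i := galRes_mem_stab (barRep ρ) i g
  rw [wreath_smul, h]
  rfl

/-- An element fixing `(i, x)` fixes `i`, hence comes from the Galois group of the fixed field at
`i`, where it acts on the fibre through `pointRep`. -/
theorem wreath_stab (ρ : Rep K Ω (Wreath A B Y)) (i : Y) (x : X) :
    ρ.stab (i, x) = ((pointRep ρ i).stab x).map (galRes _) := by
  ext g
  constructor
  · intro hg
    have hg : ρ.1 g • (i, x) = (i, x) := hg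
    have hi : g ∈ (barRep ρ).stab i := (Prod.ext_iff.1 hg).1
    refine ⟨(barRep ρ).stabLift i g hi, ?_, rfl⟩
    have := pointRep_smul ρ i x ((barRep ρ).stabLift i g hi)
    rw [Rep.galRes_stabLift, hg] at this
    exact (Prod.ext_iff.1 this).2.symm
  · rintro ⟨g, hg, rfl⟩
    refine (pointRep_smul ρ i x g).trans ?_
    rw [show (pointRep ρ i).1 g • x = x from hg]

variable [Fintype X] [Fintype Y]

/-- Ramification indices and residue degrees multiply in towers. For the former, inertia over the
fixed field at `i` is the intersection of inertia with the stabilizer of `i`, and relative indices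
multiply. -/
theorem symbolAt_wreath (O : Subring K) (ρ : Rep K Ω (Wreath A B Y)) (i : Y) (x : X) :
    symbolAt O ρ (i, x) =
      ((symbolAt O (barRep ρ) i).1 * (symbolAt (integersIn O _) (pointRep ρ i) x).1,
        (symbolAt O (barRep ρ) i).2 * (symbolAt (integersIn O _) (pointRep ρ i) x).2) := by
  have hrange : (⊤ : Subgroup _).map (galRes ((barRep ρ).pointField i)) = (barRep ρ).stab i := by
    rw [← MonoidHom.range_eq_map]
    exact SetLike.coe_injective ((barRep ρ).range_galRes i)
  have hI : (inertia (integersIn O _) Ω).map (galRes ((barRep ρ).pointField i)) =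
      (barRep ρ).stab i ⊓ inertia O Ω := by
    rw [inertia_comap_galRes, Subgroup.map_comap_eq, MonoidHom.range_eq_map, hrange]
  have hinj := galRes_injective ((barRep ρ).pointField i)
  have hle : ρ.stab (i, x) ≤ (barRep ρ).stab i := by
    rw [wreath_stab, ← hrange]
    exact Subgroup.map_mono le_top
  have h2 : (symbolAt O ρ (i, x)).2 =
      (symbolAt O (barRep ρ) i).2 * (symbolAt (integersIn O _) (pointRep ρ i) x).2 := by
    rw [symbolAt_snd, symbolAt_snd, symbolAt_snd, ← inf_of_le_left hle,
      ← Subgroup.relIndex_inf_mul_relIndex, ← hI, wreath_stab,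
      Subgroup.relIndex_map_map_of_injective _ _ hinj, mul_comm]
  have hmul : (symbolAt O ρ (i, x)).1 * (symbolAt O ρ (i, x)).2 =
      ((symbolAt O (barRep ρ) i).1 * (symbolAt O (barRep ρ) i).2) *
        ((symbolAt (integersIn O _) (pointRep ρ i) x).1 *
          (symbolAt (integersIn O _) (pointRep ρ i) x).2) := by
    rw [symbolAt_mul, symbolAt_mul, symbolAt_mul, ← Subgroup.relIndex_mul_index hle, wreath_stab,
      ← hrange, Subgroup.relIndex_map_map_of_injective _ _ hinj, Subgroup.relIndex_top_right,
      mul_comm]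
  refine Prod.ext ?_ h2
  have hpos := symbolAt_snd_pos O ρ (i, x)
  -- The residue degrees follow from the multiplicativity of the full indices by dividing by the
  -- positive inertia orbit size.
  apply Nat.eq_of_mul_eq_mul_right hpos
  rw [hmul, h2]
  ring

/-- The type of a representation in terms of its wreath type. -/
def totalType (T : List ((ℕ × ℕ) × Multiset (ℕ × ℕ))) : Multiset (ℕ × ℕ) :=
  (T.map fun t => t.2.map fun p => (t.1.1 * p.1, t.1.2 * p.2)).sum

theorem totalType_perm {T T' : List ((ℕ × ℕ) × Multiset (ℕ × ℕ))} (h : T.Perm T') :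
    totalType T = totalType T' :=
  (h.map _).sum_eq

variable [LinearOrder Y]

/-- Every orbit on `Y × X` meets the fibre over exactly one canonical representative `i`, and meets
it in a single orbit of `pointRep ρ i`. -/
theorem repType_wreath (O : Subring K) (ρ : Rep K Ω (Wreath A B Y)) :
    repType (Y × X) O ρ = totalType (wreathTerms X O ρ) := by
  choose ι hι F hF hF' _ using fun i : Y => exists_repType_eq_sum (X := X) (pointRep ρ i)
  have h := repType_eq_sum (ι := Σ i : {i : Y // i ∈ orbitReps (barRep ρ)}, ι i.1) O ρ
    (fun s => (s.1.1, F s.1.1 s.2)) ?_ ?_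
  · rw [h, totalType, wreathTerms, List.map_map]
    have h1 := Fintype.sum_sigma fun s : Σ i : {i : Y // i ∈ orbitReps (barRep ρ)}, ι i.1 =>
      ({symbolAt O ρ (s.1.1, F s.1.1 s.2)} : Multiset (ℕ × ℕ))
    refine h1.trans (Eq.trans (by congr!)
      ((sum_orbitReps (barRep ρ) fun i => ∑ s, {symbolAt O ρ (i, F i s)}).symm.trans ?_))
    congr 1
    refine List.map_congr_left fun i _ => ?_
    rw [Function.comp_apply, repType_eq_sum (integersIn O _) (pointRep ρ i) (F i) (hF i) (hF' i),
      ← Multiset.coe_mapAddMonoidHom, map_sum]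
    refine Finset.sum_congr rfl fun s _ => ?_
    rw [symbolAt_wreath, Multiset.coe_mapAddMonoidHom, Multiset.map_singleton]
  · rintro ⟨j, x⟩
    obtain ⟨g, hg⟩ := Rep.mem_orbit_range.1 (mem_orbit_repOf (barRep ρ) j)
    set i := repOf (barRep ρ) j with hi
    have hg : (ρ.1 g).right • i = j := hg
    obtain ⟨s, h, hs⟩ := hF i ((ρ.1 g)⁻¹ • (j, x)).2
    refine ⟨⟨⟨i, repOf_mem _ j⟩, s⟩, g * galRes _ h, ?_⟩
    rw [map_mul, mul_smul]
    dsimp only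
    rw [show ρ.1 (galRes _ h) • (i, F i s) = _ from pointRep_smul ρ i (F i s) h, hs]
    have h1 : ((ρ.1 g)⁻¹ • (j, x)).1 = i := by
      change (ρ.1 g)⁻¹.right • j = i
      rw [SemidirectProduct.inv_right, inv_smul_eq_iff, hg]
    rw [← h1, Prod.mk.eta, smul_inv_smul]
  · rintro ⟨⟨i, hi⟩, s⟩ ⟨⟨j, hj⟩, t⟩ g h
    have hij : i = j := orbitReps_unique _ hi hj
      (Rep.mem_orbit_range.2 ⟨g, (Prod.ext_iff.1 h).1⟩)
    subst hij
    have hg : g ∈ (barRep ρ).stab i := (Prod.ext_iff.1 h).1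
    have h1 := pointRep_smul ρ i (F i s) ((barRep ρ).stabLift i g hg)
    rw [Rep.galRes_stabLift] at h1
    have h2 := hF' i s t _ (Prod.ext_iff.1 (h1.symm.trans h)).2
    rw [h2]

end WreathTypes

/-! ### Finiteness of wreath types and mass formulas by type -/

section Finiteness

theorem finite_lists {α : Type*} {F : Set α} (hF : F.Finite) (n : ℕ) :
    {l : List α | l.length ≤ n ∧ ∀ x ∈ l, x ∈ F}.Finite := by
  have : Finite F := hF
  refine ((List.finite_length_le F n).image (List.map Subtype.val)).subset ?_
  rintro l ⟨hl, h⟩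
  refine ⟨l.attach.map fun x => ⟨x.1, h x.1 x.2⟩, by simpa using hl, ?_⟩
  rw [List.map_map]
  exact List.attach_map_subtype_val l

theorem finite_multisets {α : Type*} {F : Set α} (hF : F.Finite) (n : ℕ) :
    {s : Multiset α | s.card ≤ n ∧ ∀ x ∈ s, x ∈ F}.Finite := by
  refine ((finite_lists hF n).image Multiset.ofList).subset ?_
  rintro s ⟨hs, h⟩
  induction s using Quotient.inductionOn with
  | h l => exact ⟨l, ⟨by simpa using hs, by simpa using h⟩, rfl⟩

/-- A finite set that contains all types of representations on a set with `n` elements. -/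
def typeBound (n : ℕ) : Set (Multiset (ℕ × ℕ)) :=
  {s | s.card ≤ n ∧ ∀ x ∈ s, x ∈ Set.Iic n ×ˢ Set.Iic n}

theorem finite_typeBound (n : ℕ) : (typeBound n).Finite :=
  finite_multisets ((Set.finite_Iic n).prod (Set.finite_Iic n)) n

theorem repType_mem_typeBound {K Ω : Type u} [Field K] [Field Ω] [Algebra K Ω] {Γ X : Type*}
    [Group Γ] [MulAction Γ X] [Fintype X] (O : Subring K) (ρ : Rep K Ω Γ) :
    repType X O ρ ∈ typeBound (Fintype.card X) := by
  classical
  constructor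
  · rw [repType, Multiset.card_map]
    exact Fintype.card_le_of_surjective _ Quotient.mk_surjective
  · intro x hx
    obtain ⟨o, _, rfl⟩ := Multiset.mem_map.1 hx
    exact ⟨(symbolAt_le O ρ _).1, (symbolAt_le O ρ _).2⟩

/-- A finite set that contains all lists of terms of representations into a wreath product that
acts on the product of a set with `m` elements and a set with `n` elements. -/
def termsBound (m n : ℕ) : Set (List ((ℕ × ℕ) × Multiset (ℕ × ℕ))) :=
  {l | l.length ≤ m ∧ ∀ t ∈ l, t ∈ (Set.Iic m ×ˢ Set.Iic m) ×ˢ typeBound n}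

theorem finite_termsBound (m n : ℕ) : (termsBound m n).Finite :=
  finite_lists (((Set.finite_Iic m).prod (Set.finite_Iic m)).prod (finite_typeBound n)) m

end Finiteness

section WreathMassFormula

variable {K Ω : Type u} [Field K] [Field Ω] [Algebra K Ω] [IsSepClosure K Ω]
variable {A B X Y : Type*} [Group A] [Group B] [MulAction A X] [Fintype X] [MulAction B Y]
  [Fintype Y] [LinearOrder Y]

theorem wreathTerms_mem_termsBound (O : Subring K) (ρ : Rep K Ω (Wreath A B Y)) :
    wreathTerms X O ρ ∈ termsBound (Fintype.card Y) (Fintype.card X) := by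
  constructor
  · rw [wreathTerms, List.length_map]
    exact length_orbitReps_le _
  · intro t ht
    obtain ⟨i, _, rfl⟩ := List.mem_map.1 ht
    exact ⟨⟨(symbolAt_le O _ _).1, (symbolAt_le O _ _).2⟩, repType_mem_typeBound _ _⟩

/-- Wreath types are lists of terms up to this relation. -/
def wreathTypeSetoid : Setoid (List ((ℕ × ℕ) × Multiset (ℕ × ℕ))) where
  r := SameTerms
  iseqv := ⟨fun _ _ => rfl, fun h => h.symm, fun h h' => h.trans h'⟩

/-- The possible wreath types of representations of type `σ`. -/
abbrev WreathTypes (m n : ℕ) (σ : Multiset (ℕ × ℕ)) :=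
  {q : Quotient wreathTypeSetoid // q ∈ Quotient.mk wreathTypeSetoid '' termsBound m n ∧
    totalType q.out = σ}

instance (m n : ℕ) (σ : Multiset (ℕ × ℕ)) : Finite (WreathTypes m n σ) :=
  Set.Finite.subset ((finite_termsBound m n).image _) fun _ h => h.1

/-- Different lists can describe the same wreath type. Choosing one list per class makes each
representation counted exactly once. -/
theorem hasWreathType_iff_mk_eq {O : Subring K} {ρ : Rep K Ω (Wreath A B Y)}
    {q : Quotient wreathTypeSetoid} :
    HasWreathType X O ρ q.out ↔ Quotient.mk wreathTypeSetoid (wreathTerms X O ρ) = q := by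
  constructor
  · intro h
    rw [← Quotient.out_eq q]
    exact Quotient.sound h
  · rintro rfl
    exact Setoid.symm' wreathTypeSetoid (Quotient.mk_out (s := wreathTypeSetoid) _)

theorem HasWreathType.repType_eq {O : Subring K} {ρ : Rep K Ω (Wreath A B Y)}
    {T : List ((ℕ × ℕ) × Multiset (ℕ × ℕ))} (h : HasWreathType X O ρ T) :
    repType (Y × X) O ρ = totalType T := by
  rw [repType_wreath]
  exact totalType_perm (SameTerms.perm h)

/-- The representations of a given type, sorted by their wreath types. -/
def sigmaWreathTypes (A B X Y : Type*) [Group A] [Group B] [MulAction A X] [Fintype X]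
    [MulAction B Y] [Fintype Y] [LinearOrder Y] (Ω : Type u) [Field Ω] [Algebra K Ω]
    [IsSepClosure K Ω] (O : Subring K) (σ : Multiset (ℕ × ℕ)) :
    {ρ : Rep K Ω (Wreath A B Y) // repType (Y × X) O ρ = σ} ≃
      Σ q : WreathTypes (Fintype.card Y) (Fintype.card X) σ,
        {ρ : Rep K Ω (Wreath A B Y) // HasWreathType X O ρ q.1.out} where
  toFun ρ := ⟨⟨Quotient.mk wreathTypeSetoid (wreathTerms X O ρ.1),
    ⟨_, wreathTerms_mem_termsBound O ρ.1, rfl⟩, by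
      rw [← (hasWreathType_iff_mk_eq.2 rfl : HasWreathType X O ρ.1 _).repType_eq, ρ.2]⟩,
    ⟨ρ.1, hasWreathType_iff_mk_eq.2 rfl⟩⟩
  invFun x := ⟨x.2.1, x.2.2.repType_eq.trans x.1.2.2⟩
  left_inv _ := rfl
  right_inv := by
    rintro ⟨⟨q, hq⟩, ⟨ρ, hρ⟩⟩
    obtain rfl := hasWreathType_iff_mk_eq.1 hρ
    rfl

/-- The polynomials of the wreath types with total type `σ` are added. The index set is finite and
depends only on `σ` and the sizes of `X` and `Y`, so one polynomial works for all `K` and `Ω`;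
composing with a power of the variable replaces `1/q_K` by `1/q_K^{f_k}`. -/
theorem hasMassFormulasByType_wreath [Finite A] {S : FieldClass.{u}} {cA : RepFunction.{u} A}
    {cB : RepFunction.{u} B} (hSc : ContainsPointFields S B Y)
    (hA : HasMassFormulasByType X S cA) (hB : HasMassFormulasByType Y S cB) :
    HasMassFormulasByType (Y × X) S (wreathCount Y cA cB) := by
  classical
  choose fA hA using hA
  choose fB hB using hB
  intro σ
  have := Fintype.ofFinite (WreathTypes (Fintype.card Y) (Fintype.card X) σ)
  refine ⟨∑ q : WreathTypes (Fintype.card Y) (Fintype.card X) σ,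
    Polynomial.C ((Nat.card A : ℤ) ^ (Fintype.card Y - q.1.out.length)) *
      fB (Multiset.ofList (q.1.out.map Prod.fst)) *
      (q.1.out.map fun t => (fA t.2).comp (Polynomial.X ^ t.1.1)).prod, ?_⟩
  intro K Ω _ _ _ _ O hO hS
  rw [← (sigmaWreathTypes A B X Y Ω O σ).symm.hasSum_iff]
  refine hasSum_sigma_of_nonneg (fun x => by simp only [Function.comp_apply]; positivity)
    (fun q => hasSum_wreathType S cA cB hSc fA fB hA hB hO hS q.1.out) ?_
  refine hasSum_congr (hasSum_fintype _) (fun _ => rfl) ?_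
  rw [map_sum]
  refine Finset.sum_congr rfl fun q _ => ?_
  rw [map_mul, map_mul, map_list_prod, List.map_map]
  congr 1
  · simp
  · congr 1
    refine List.map_congr_left fun t _ => ?_
    simp [Polynomial.aeval_comp]

end WreathMassFormula

/-! ### Direct products -/

section Product

variable {K Ω : Type u} [Field K] [Field Ω] [Algebra K Ω]
variable {A B X Y : Type*} [Group A] [Group B] [MulAction A X] [MulAction B Y]

/-- Representations into a direct product are pairs of representations. -/
def repProdEquiv (K Ω A B : Type*) [Field K] [Field Ω] [Algebra K Ω] [Group A] [Group B] :
    Rep K Ω (A × B) ≃ Rep K Ω A × Rep K Ω B where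
  toFun ρ := (ρ.map (MonoidHom.fst A B), ρ.map (MonoidHom.snd A B))
  invFun ρ := ⟨ρ.1.1.prod ρ.2.1, continuous_of_eq_one _ _ (ρ.1.isOpen_ker.inter ρ.2.isOpen_ker)
    ⟨map_one _, map_one _⟩ fun _ h => Prod.ext h.1 h.2⟩
  left_inv _ := rfl
  right_inv _ := rfl

theorem isCountingFunction_prodCount {cA : RepFunction.{u} A} {cB : RepFunction.{u} B}
    (hcA : IsCountingFunction cA) (hcB : IsCountingFunction cB) :
    IsCountingFunction (prodCount cA cB) := by
  constructor
  · intro K Ω _ _ _ _ O hO ρ γ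
    exact congrArg₂ (· + ·) (hcA.conj_eq K Ω O hO (ρ.map (MonoidHom.fst A B)) γ.1)
      (hcB.conj_eq K Ω O hO (ρ.map (MonoidHom.snd A B)) γ.2)
  · intro K Ω _ _ _ _ O K' Ω' _ _ _ _ O' hO hO' e E hOO' hE ρ ρ' h
    exact congrArg₂ (· + ·)
      (hcA.iso_eq K Ω O K' Ω' O' hO hO' e E hOO' hE (ρ.map (MonoidHom.fst A B)) _
        fun g g' hg => congrArg Prod.fst (h g g' hg))
      (hcB.iso_eq K Ω O K' Ω' O' hO hO' e E hOO' hE (ρ.map (MonoidHom.snd A B)) _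
        fun g g' hg => congrArg Prod.snd (h g g' hg))

theorem symbolAt_congr {Γ Γ' X X' : Type*} [Group Γ] [Group Γ'] [MulAction Γ X] [MulAction Γ' X']
    (O : Subring K) (ρ : Rep K Ω Γ) (ρ' : Rep K Ω Γ') {x : X} {x' : X'}
    (h : ρ.stab x = ρ'.stab x') : symbolAt O ρ x = symbolAt O ρ' x' :=
  Prod.ext (by rw [symbolAt_fst, symbolAt_fst, h]) (by rw [symbolAt_snd, symbolAt_snd, h])

/-- Each orbit on the disjoint union lies in one summand, and its symbol depends only on the
stabilizer, which is that of the corresponding projection. -/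
theorem repType_prod [Fintype X] [Fintype Y] (O : Subring K) (ρ : Rep K Ω (A × B)) :
    repType (X ⊕ Y) O ρ =
      repType X O (ρ.map (MonoidHom.fst A B)) + repType Y O (ρ.map (MonoidHom.snd A B)) := by
  obtain ⟨ι, _, F, hF, hF', _⟩ := exists_repType_eq_sum (X := X) (ρ.map (MonoidHom.fst A B))
  obtain ⟨κ, _, G, hG, hG', _⟩ := exists_repType_eq_sum (X := Y) (ρ.map (MonoidHom.snd A B))
  rw [repType_eq_sum O _ F hF hF', repType_eq_sum O _ G hG hG',
    repType_eq_sum (ι := ι ⊕ κ) O ρ (Sum.map F G), Fintype.sum_sum_type]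
  · congr 1
    · refine Finset.sum_congr rfl fun i _ => congrArg _ (symbolAt_congr O _ _ ?_)
      ext g
      exact Sum.inl_injective.eq_iff
    · refine Finset.sum_congr rfl fun i _ => congrArg _ (symbolAt_congr O _ _ ?_)
      ext g
      exact Sum.inr_injective.eq_iff
  · rintro (x | y)
    · obtain ⟨i, g, h⟩ := hF x
      exact ⟨Sum.inl i, g, congrArg Sum.inl h⟩
    · obtain ⟨i, g, h⟩ := hG y
      exact ⟨Sum.inr i, g, congrArg Sum.inr h⟩
  · rintro (i | i) (j | j) g h
    · exact congrArg Sum.inl (hF' i j g (Sum.inl_injective h))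
    · exact absurd h Sum.inl_ne_inr
    · exact absurd h Sum.inr_ne_inl
    · exact congrArg Sum.inr (hG' i j g (Sum.inr_injective h))

variable [IsSepClosure K Ω] [Fintype X] [Fintype Y]

/-- Representations of a given product type. -/
def productTypeEquiv (A B X Y : Type*) [Group A] [Group B] [MulAction A X] [MulAction B Y]
    [Fintype X] [Fintype Y] (O : Subring K) (σ τ : Multiset (ℕ × ℕ)) :
    {ρ : Rep K Ω (A × B) // HasProductType X Y O ρ σ τ} ≃
      {ρ : Rep K Ω A // repType X O ρ = σ} × {ρ : Rep K Ω B // repType Y O ρ = τ} where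
  toFun ρ := (⟨(repProdEquiv K Ω A B ρ.1).1, ρ.2.1⟩, ⟨(repProdEquiv K Ω A B ρ.1).2, ρ.2.2⟩)
  invFun ρ := ⟨(repProdEquiv K Ω A B).symm (ρ.1.1, ρ.2.1), ρ.1.2, ρ.2.2⟩
  left_inv _ := rfl
  right_inv _ := rfl

theorem hasSum_productType {S : FieldClass.{u}} {cA : RepFunction.{u} A} {cB : RepFunction.{u} B}
    {σ τ : Multiset (ℕ × ℕ)} {f g : Polynomial ℤ} (hA : IsMassFormula X S cA σ f)
    (hB : IsMassFormula Y S cB τ g) {O : Subring K} (hO : IsLocalField K O) (hS : S K O) :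
    HasSum (fun ρ : {ρ : Rep K Ω (A × B) // HasProductType X Y O ρ σ τ} =>
        ((residueCard O : ℝ) ^ prodCount cA cB K Ω O ρ.1)⁻¹)
      (Polynomial.aeval ((residueCard O : ℝ)⁻¹) f * Polynomial.aeval ((residueCard O : ℝ)⁻¹) g) := by
  have h := hasSum_mul_of_nonneg (hA K Ω O hO hS) (hB K Ω O hO hS) (fun _ => by positivity)
    (fun _ => by positivity)
  rw [← (productTypeEquiv A B X Y O σ τ).hasSum_iff] at h
  refine hasSum_congr h (fun ρ => ?_) rfl
  rw [Function.comp_apply, ← mul_inv, ← pow_add]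
  rfl

/-- The representations of a given type, sorted by their product types. -/
def sigmaProductTypes (A B X Y : Type*) [Group A] [Group B] [MulAction A X] [MulAction B Y]
    [Fintype X] [Fintype Y] (Ω : Type u) [Field Ω] [Algebra K Ω] (O : Subring K)
    (σ : Multiset (ℕ × ℕ)) :
    {ρ : Rep K Ω (A × B) // repType (X ⊕ Y) O ρ = σ} ≃
      Σ p : {p : Multiset (ℕ × ℕ) × Multiset (ℕ × ℕ) // p.1 + p.2 = σ},
        {ρ : Rep K Ω (A × B) // HasProductType X Y O ρ p.1.1 p.1.2} where
  toFun ρ := ⟨⟨(repType X O (ρ.1.map (MonoidHom.fst A B)), repType Y O (ρ.1.map (MonoidHom.snd A B))),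
    (repType_prod O ρ.1).symm.trans ρ.2⟩, ⟨ρ.1, rfl, rfl⟩⟩
  invFun x := ⟨x.2.1, (repType_prod O x.2.1).trans (by rw [x.2.2.1, x.2.2.2, x.1.2])⟩
  left_inv _ := rfl
  right_inv := by
    rintro ⟨⟨⟨σ, τ⟩, h⟩, ⟨ρ, h1, h2⟩⟩
    dsimp only at h1 h2
    subst h1 h2
    rfl

/-- A multiset `σ` is a sum of two multisets in finitely many ways, so the polynomial is a finite
sum of products over these decompositions. -/
theorem hasMassFormulasByType_prod {S : FieldClass.{u}} {cA : RepFunction.{u} A}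
    {cB : RepFunction.{u} B} (hA : HasMassFormulasByType X S cA)
    (hB : HasMassFormulasByType Y S cB) :
    HasMassFormulasByType (X ⊕ Y) S (prodCount cA cB) := by
  classical
  choose fA hA using hA
  choose fB hB using hB
  intro σ
  have : Finite {p : Multiset (ℕ × ℕ) × Multiset (ℕ × ℕ) // p.1 + p.2 = σ} :=
    Set.Finite.subset (Multiset.toFinset (Multiset.antidiagonal σ)).finite_toSet
      fun p (h : p.1 + p.2 = σ) => by simpa using h
  have := Fintype.ofFinite {p : Multiset (ℕ × ℕ) × Multiset (ℕ × ℕ) // p.1 + p.2 = σ}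
  refine ⟨∑ p : {p : Multiset (ℕ × ℕ) × Multiset (ℕ × ℕ) // p.1 + p.2 = σ}, fA p.1.1 * fB p.1.2, ?_⟩
  intro K Ω _ _ _ _ O hO hS
  rw [← (sigmaProductTypes A B X Y Ω O σ).symm.hasSum_iff]
  refine hasSum_sigma_of_nonneg (fun x => by simp only [Function.comp_apply]; positivity)
    (fun p => hasSum_productType (hA p.1.1) (hB p.1.2) hO hS) ?_
  refine hasSum_congr (hasSum_fintype _) (fun _ => rfl) ?_
  rw [map_sum]
  exact Finset.sum_congr rfl fun p _ => map_mul _ _ _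

end Product

end MassFormula

end

theorem theorem2 {A B X Y : Type*} [Group A] [Finite A] [Group B] [Finite B]
    [Fintype X] [MulAction A X] [Fintype Y] [LinearOrder Y] [MulAction B Y]
    (S : MassFormula.FieldClass.{u})
    (cA : MassFormula.RepFunction.{u} A) (cB : MassFormula.RepFunction.{u} B)
    (hcA : MassFormula.IsCountingFunction cA) (hcB : MassFormula.IsCountingFunction cB)
    (hA : MassFormula.HasMassFormulasByType X S cA)
    (hB : MassFormula.HasMassFormulasByType Y S cB) :
    -- wreath products
    (MassFormula.IsCountingFunction (MassFormula.wreathCount Y cA cB) ∧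
      (MassFormula.ContainsPointFields S B Y →
        MassFormula.HasMassFormulasByType (Y × X) S (MassFormula.wreathCount Y cA cB) ∧
        ∀ fA fB : Multiset (ℕ × ℕ) → Polynomial ℤ,
          (∀ σ, MassFormula.IsMassFormula X S cA σ (fA σ)) →
          (∀ σ, MassFormula.IsMassFormula Y S cB σ (fB σ)) →
          ∀ (T : List ((ℕ × ℕ) × Multiset (ℕ × ℕ)))
            (K Ω : Type u) [Field K] [Field Ω] [Algebra K Ω] [IsSepClosure K Ω] (O : Subring K),
            MassFormula.IsLocalField K O → S K O →
            HasSum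
              (fun ρ : {ρ : MassFormula.Rep K Ω (MassFormula.Wreath A B Y) //
                  MassFormula.HasWreathType X O ρ T} =>
                ((MassFormula.residueCard O : ℝ) ^
                  MassFormula.wreathCount Y cA cB K Ω O ρ.1)⁻¹)
              ((Nat.card A : ℝ) ^ (Fintype.card Y - T.length) *
                Polynomial.aeval ((MassFormula.residueCard O : ℝ)⁻¹)
                  (fB (Multiset.ofList (T.map Prod.fst))) *
                (T.map fun t =>
                  Polynomial.aeval (((MassFormula.residueCard O : ℝ) ^ t.1.1)⁻¹) (fA t.2)).prod))) ∧
    -- direct products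
    (MassFormula.IsCountingFunction (MassFormula.prodCount cA cB) ∧
      MassFormula.HasMassFormulasByType (X ⊕ Y) S (MassFormula.prodCount cA cB) ∧
      ∀ fA fB : Multiset (ℕ × ℕ) → Polynomial ℤ,
        (∀ σ, MassFormula.IsMassFormula X S cA σ (fA σ)) →
        (∀ σ, MassFormula.IsMassFormula Y S cB σ (fB σ)) →
        ∀ (σ τ : Multiset (ℕ × ℕ))
          (K Ω : Type u) [Field K] [Field Ω] [Algebra K Ω] [IsSepClosure K Ω] (O : Subring K),
          MassFormula.IsLocalField K O → S K O →
          HasSum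
            (fun ρ : {ρ : MassFormula.Rep K Ω (A × B) // MassFormula.HasProductType X Y O ρ σ τ} =>
              ((MassFormula.residueCard O : ℝ) ^ MassFormula.prodCount cA cB K Ω O ρ.1)⁻¹)
            (Polynomial.aeval ((MassFormula.residueCard O : ℝ)⁻¹) (fA σ) *
              Polynomial.aeval ((MassFormula.residueCard O : ℝ)⁻¹) (fB τ))) := by
  exact ⟨⟨MassFormula.isCountingFunction_wreathCount hcA hcB, fun hSc =>
      ⟨MassFormula.hasMassFormulasByType_wreath hSc hA hB, fun fA fB hfA hfB T K Ω _ _ _ _ O hO hS =>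
        MassFormula.hasSum_wreathType S cA cB hSc fA fB hfA hfB hO hS T⟩⟩,
    MassFormula.isCountingFunction_prodCount hcA hcB,
    MassFormula.hasMassFormulasByType_prod hA hB, fun fA fB hfA hfB σ τ K Ω _ _ _ _ O hO hS =>
      MassFormula.hasSum_productType (hfA σ) (hfB τ) hO hS⟩
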